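/- Let $A=\bigoplus_{i\ge 0}A_i$ be a commutative Noetherian $\mathbb N$-graded ring with $1$. For $a\in A_0$ and $b=\sum_i b_i\in A$ ($b_i\in A_i$) put $b^+(a)=\sum_i b_i a^i$; this is a ring endomorphism of $A$, and applied to the entries it gives $\alpha\mapsto\alpha^+(a)$ on $\mathrm{GL}_n(A)$. Consider one of the following three cases, for a commutative ring $R$, where in the last two $n=2m$, $\sigma$ is the permutation of $\{1,\dots,2m\}$ exchanging $2k-1$ and $2k$, and $\psi$, $\widetilde\psi$ are the block diagonal $2m\times 2m$ matrices with $m$ blocks $\begin{pmatrix}0&1\\-1&0\end{pmatrix}$, resp. $\begin{pmatrix}0&1\\1&0\end{pmatrix}$. - Linear case, $n\ge 3$: $\mathrm G(n,R)=\mathrm{GL}_n(R)$; $\mathrm E(n,R)$ is generated by all $\mathrm I_n+ze_{ij}$ with $i\ne j$, $z\in R$; $\langle v,w\rangle=v^tw$; $M(v,w)=vw^t$. - Symplectic case, $n=2m\ge 6$: $\mathrm G(n,R)=\{\alpha\in \mathrm{GL}_n(R):\alpha^t\psi\alpha=\psi\}$; $\mathrm E(n,R)$ is generated by all $\mathrm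 I_n+ze_{ij}$ with $i=\sigma(j)$ and all $\mathrm I_n+ze_{ij}-(-1)^{i+j}ze_{\sigma(j)\sigma(i)}$ with $i\neq\sigma(j)$, $i<j$; with $\widetilde v=v^t\psi$, $\langle v,w\rangle=\widetilde v w$ and $M(v,w)=v\widetilde w+w\widetilde v$. - Orthogonal case, $n=2m\ge 6$, assuming that $2$ is a non-zero-divisor in $A$: $\mathrm G(n,R)=\{\alpha\in \mathrm{GL}_n(R):\alpha^t\widetilde\psi\alpha=\widetilde\psi\}$; $\mathrm E(n,R)$ is generated by all $\mathrm I_n+ze_{ij}-ze_{\sigma(j)\sigma(i)}$ with $i\ne\sigma(j)$, $i<j$; with $\widetilde v=v^t\widetilde\psi$, $\langle v,w\rangle=\widetilde v w$ and $M(v,w)=v\widetilde w-w\widetilde v$. Call $(v,w)\in A^n\times A^n$ admissible if $\langle v,w\rangle=0$ and, in the orthogonal case, also $\langle v,v\rangle=\langle w,w\rangle=0$. A vector $v\in A^n$ is unimodular if $\sum_i v_ib_i=1$ for some $b\in A^n$. For a maximal ideal $\mathfrak m$ of $A_0$, $A_{\mathfrak m}$ is the localization of $A$ at $A_0\setminus\mathfrak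 m$, and for $s\in A_0$, $A_s$ is the localization of $A$ at the powers of $s$; $\alpha_{\mathfrak m}$ and $\alpha_s$ denote the images of $\alpha\in\mathrm{GL}_n(A)$. Then in each case the following are equivalent: 1. $\mathrm E(n,A)$ is a normal subgroup of $\mathrm G(n,A)$. 2. If $v$ is unimodular and $(v,w)$ is admissible, then $\mathrm I_n+M(v,w)\in\mathrm E(n,A)$. 3. (Local-Global Principle) If $\alpha\in\mathrm G(n,A)$, $\alpha^+(0)=\mathrm I_n$ and $\alpha_{\mathfrak m}\in\mathrm E(n,A_{\mathfrak m})$ for every maximal ideal $\mathfrak m$ of $A_0$, then $\alpha\in\mathrm E(n,A)$. 4. (Dilation Lemma) If $\alpha\in\mathrm G(n,A)$, $\alpha^+(0)=\mathrm I_n$ and $\alpha_s\in\mathrm E(n,A_s)$ for some $s\in A_0$ that is a non-zero-divisor in $A$, then for all sufficiently large $l$ there is $\beta\in\mathrm E(n,A)$ with $\beta_s=(\alpha^+(s^l))_s$. 5. If $\alpha\in\mathrm E(n,A)$, then $\alpha^+(a)\in\mathrm E(n,A)$ for every $a\in A_0$. 6. If $v=\varepsilon e_1$ with $\varepsilon\in\mathrm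 E(n,A)$, where $e_1=(1,0,\dots,0)^t$, and $(v,w)$ is admissible, then $\mathrm I_n+M(v,w)\in\mathrm E(n,A)$. -/

import Mathlib

open scoped Matrix Polynomial

namespace GradedClassical

/-- The three families of classical groups treated uniformly. -/
inductive Kind
  | linear
  | symplectic
  | orthogonal

/-- The sizes considered: `n ≥ 3` in the linear case, `n = 2m ≥ 6` in the other two cases. -/
def Kind.Admissible : Kind → ℕ → Prop
  | .linear, n => 3 ≤ n
  | .symplectic, n => Even n ∧ 6 ≤ n
  | .orthogonal, n => Even n ∧ 6 ≤ n

/-! ### The graded homotopy `α ↦ α⁺(a)` -/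

section Homotopy

variable {A : Type*} [CommRing A] (𝒜 : ℕ → AddSubgroup A) [GradedRing 𝒜]

/-- The ring homomorphism `ε : A → A[X]`, `b₀ + b₁ + b₂ + ⋯ ↦ b₀ + b₁ X + b₂ X² + ⋯`. -/
noncomputable def epsilon : A →+* A[X] :=
  (DirectSum.toSemiring (A := fun i => 𝒜 i)
    (fun i => (Polynomial.monomial i).toAddMonoidHom.comp (𝒜 i).subtype)
    (by simp)
    (by intro i j x y; simp [Polynomial.monomial_mul_monomial])).comp
    (DirectSum.decomposeRingEquiv 𝒜).toRingHom

/-- The ring endomorphism `b ↦ b⁺(a) = ε(b)(a)` of `A`, for `a ∈ A₀`. -/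
noncomputable def plusHom (a : 𝒜 0) : A →+* A :=
  (Polynomial.evalRingHom (a : A)).comp (epsilon 𝒜)

/-- The matrix `α⁺(a)`, for `α ∈ GL_n(A)` and `a ∈ A₀`. -/
noncomputable def plus {n : ℕ} (α : GL (Fin n) A) (a : 𝒜 0) : GL (Fin n) A :=
  Matrix.GeneralLinearGroup.map (plusHom 𝒜 a) α

end Homotopy

/-! ### The forms and the classical groups -/

/-- The permutation `σ`. With indices starting at `0` it exchanges `2k` and `2k + 1`.
(If `n` is odd, which is irrelevant here, the last index is fixed.) -/
def partner {n : ℕ} (i : Fin n) : Fin n :=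
  if (i : ℕ) % 2 = 0 then
    if h : (i : ℕ) + 1 < n then ⟨i + 1, h⟩ else i
  else ⟨i - 1, by omega⟩

section Groups

variable (n : ℕ) (R : Type*) [CommRing R]

/-- The alternating form `ψ_m`: block diagonal with `m` blocks `(0, 1; -1, 0)`. -/
def psi : Matrix (Fin n) (Fin n) R :=
  Matrix.of fun i j => if j = partner i then (if (i : ℕ) % 2 = 0 then 1 else -1) else 0

/-- The symmetric form `ψ̃_m`: block diagonal with `m` blocks `(0, 1; 1, 0)`. -/
def psiTilde : Matrix (Fin n) (Fin n) R :=
  Matrix.of fun i j => if j = partner i then 1 else 0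

variable {n R}

/-- The group of all `g ∈ GL_n(R)` with `gᵗ B g = B`. -/
def isometryGroup (B : Matrix (Fin n) (Fin n) R) : Subgroup (GL (Fin n) R) where
  carrier := {g | (g : Matrix (Fin n) (Fin n) R)ᵀ * B * (g : Matrix (Fin n) (Fin n) R) = B}
  one_mem' := by simp
  mul_mem' := by
    intro a b ha hb
    simp only [Set.mem_ofPred_eq] at ha hb ⊢
    calc _ = (b : Matrix (Fin n) (Fin n) R)ᵀ * ((a : Matrix (Fin n) (Fin n) R)ᵀ * B *
              (a : Matrix (Fin n) (Fin n) R)) * (b : Matrix (Fin n) (Fin n) R) := by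
            simp [Matrix.transpose_mul, Matrix.mul_assoc]
      _ = B := by rw [ha, hb]
  inv_mem' := by
    intro a ha
    simp only [Set.mem_ofPred_eq] at ha ⊢
    set P := (a : Matrix (Fin n) (Fin n) R)
    set Q := ((a⁻¹ : GL (Fin n) R) : Matrix (Fin n) (Fin n) R)
    have h1 : P * Q = 1 := by
      have := congrArg Units.val (mul_inv_cancel a)
      simpa only [Units.val_mul, Units.val_one] using this
    have h2 : Qᵀ * Pᵀ = 1 := by rw [← Matrix.transpose_mul, h1, Matrix.transpose_one]
    calc Qᵀ * B * Q = Qᵀ * (Pᵀ * B * P) * Q := by rw [ha]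
      _ = (Qᵀ * Pᵀ) * B * (P * Q) := by simp only [Matrix.mul_assoc]
      _ = B := by rw [h1, h2, Matrix.one_mul, Matrix.mul_one]

variable (n R) in
/-- `G(n, R)`: the group `GL_n(R)`, `Sp_n(R)` or `O_n(R)`. -/
def G : Kind → Subgroup (GL (Fin n) R)
  | .linear => ⊤
  | .symplectic => isometryGroup (psi n R)
  | .orthogonal => isometryGroup (psiTilde n R)

/-- `M` is one of the elementary generators:
* linear case: `I + z e_{ij}` with `i ≠ j`;
* symplectic case: `I + z e_{ij}` with `i = σ(j)`, or
  `I + z e_{ij} - (-1)^{i+j} z e_{σ(j)σ(i)}` with `i ≠ σ(j)`, `i < j`;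
* orthogonal case: `I + z e_{ij} - z e_{σ(j)σ(i)}` with `i ≠ σ(j)`, `i < j`. -/
def IsElementaryGenerator : Kind → Matrix (Fin n) (Fin n) R → Prop
  | .linear, M => ∃ (i j : Fin n) (z : R), i ≠ j ∧ M = 1 + Matrix.single i j z
  | .symplectic, M =>
      (∃ (i j : Fin n) (z : R), i ≠ j ∧ i = partner j ∧ M = 1 + Matrix.single i j z) ∨
      (∃ (i j : Fin n) (z : R), i < j ∧ i ≠ partner j ∧
        M = 1 + Matrix.single i j z -
          Matrix.single (partner j) (partner i) ((-1) ^ ((i : ℕ) + (j : ℕ)) * z))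
  | .orthogonal, M =>
      ∃ (i j : Fin n) (z : R), i < j ∧ i ≠ partner j ∧
        M = 1 + Matrix.single i j z - Matrix.single (partner j) (partner i) z

variable (n R) in
/-- `E(n, R)`: the elementary subgroup `E_n(R)`, `ESp_n(R)` or `EO_n(R)`, i.e. the subgroup
generated by the elementary generators. -/
def E (c : Kind) : Subgroup (GL (Fin n) R) :=
  Subgroup.closure {g | IsElementaryGenerator c (g : Matrix (Fin n) (Fin n) R)}

/-! ### Vectors, inner products and the matrices `M(v, w)` -/

/-- The inner product: `vᵗ w`, `vᵗ ψ w` or `vᵗ ψ̃ w`. -/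
def form : Kind → (Fin n → R) → (Fin n → R) → R
  | .linear, v, w => v ⬝ᵥ w
  | .symplectic, v, w => (v ᵥ* psi n R) ⬝ᵥ w
  | .orthogonal, v, w => (v ᵥ* psiTilde n R) ⬝ᵥ w

/-- The matrix `M(v, w)`: `v wᵗ`, `v w̃ + w ṽ` or `v w̃ - w ṽ`, where `ṽ = vᵗ ψ` in the
symplectic and `ṽ = vᵗ ψ̃` in the orthogonal case. -/
def transMatrix : Kind → (Fin n → R) → (Fin n → R) → Matrix (Fin n) (Fin n) R
  | .linear, v, w => Matrix.vecMulVec v w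
  | .symplectic, v, w =>
      Matrix.vecMulVec v (w ᵥ* psi n R) + Matrix.vecMulVec w (v ᵥ* psi n R)
  | .orthogonal, v, w =>
      Matrix.vecMulVec v (w ᵥ* psiTilde n R) - Matrix.vecMulVec w (v ᵥ* psiTilde n R)

/-- The pairs `(v, w)` for which `I + M(v, w)` is considered: `⟨v, w⟩ = 0` and, in the orthogonal
case, both vectors are isotropic. -/
def TransPair : Kind → (Fin n → R) → (Fin n → R) → Prop
  | .linear, v, w => form .linear v w = 0
  | .symplectic, v, w => form .symplectic v w = 0
  | .orthogonal, v, w =>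
      form .orthogonal v w = 0 ∧ form .orthogonal v v = 0 ∧ form .orthogonal w w = 0

/-- `v` is unimodular: `∑ vᵢ bᵢ = 1` for some `b`. -/
def IsUnimodular (v : Fin n → R) : Prop := ∃ b : Fin n → R, v ⬝ᵥ b = 1

/-- The matrix `P` belongs to `E(n, R)`. -/
def MemE (c : Kind) (P : Matrix (Fin n) (Fin n) R) : Prop :=
  ∃ g ∈ E n R c, (g : Matrix (Fin n) (Fin n) R) = P

variable (n R) in
/-- The first standard basis vector `e₁`. -/
def e₁ : Fin n → R := fun i => if (i : ℕ) = 0 then 1 else 0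

end Groups

/-! ### Localizations -/

section Localizations

variable {A : Type*} [CommRing A] (𝒜 : ℕ → AddSubgroup A) [GradedRing 𝒜]

/-- `A_𝔪`: the localization of `A` at the multiplicative set `A₀ ∖ 𝔪`. -/
abbrev LocAt (𝔪 : Ideal (𝒜 0)) [𝔪.IsPrime] : Type _ :=
  Localization (𝔪.primeCompl.map (algebraMap (𝒜 0) A))

/-- The image of a matrix of `GL_n(A)` in `GL_n(B)` for a commutative `A`-algebra `B`, used for
`B = A_𝔪` (giving `α_𝔪`) and `B = A_s` (giving `α_s`). -/
def locGL {n : ℕ} (B : Type*) [CommRing B] [Algebra A B] (α : GL (Fin n) A) : GL (Fin n) B :=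
  Matrix.GeneralLinearGroup.map (algebraMap A B) α

end Localizations

end GradedClassical

open GradedClassical

/-! All six statements hold outright, so their equivalence is immediate; no implication between them
is needed.

The engine is a Quillen–Suslin argument over `A[X]`. Let `C` be the localization of `A` at `S`, and
let `δ ∈ GL_n(A[X])` become elementary over `C[X]`. Then some `s ∈ S` satisfies `δ(y + s x) δ(y)⁻¹ ∈
E(n, A)` for all `x, y ∈ A` (`exists_forall_map_mul_inv_mem_E`). To see this, filter `E(n, C)` by
the subgroups generated by elementary matrices with parameters in the image of `mA`, `m ∈ S`.
Conjugation by an elementary matrix is continuous for this filtration (`conjMem_elem`): generators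
in general position are handled directly, opposite ones through commutator formulas, which need room
for an extra index. So specializations of `δ` at close points differ by an element of high level. As
`A` is Noetherian, `m` can be chosen with `A → C` injective on `mA`, and the factorization descends
to `A`. The admissible `s` form an ideal (`quillenIdeal`); when it is the unit ideal, `δ(1) δ(0)⁻¹`
is elementary.

This is used twice. For unimodular `v`, take `δ` to be `I + M(v, w)` with `w` replaced by `X w`.
Once a coordinate of `v` is invertible, `δ` is elementary (`memElem_siegel_of_unit`,
`memElem_one_add_vecMulVec_of_unit`), so all coordinates of `v` lie in the radical of the ideal.
This settles both statements about vectors and, since conjugates of generators are transformations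
of the same kind, normality. For the graded statements take `δ = ε(α)`, where `δ(a) = α⁺(a)` and
`δ(1) = α`. Stability under the homotopy is functoriality of `E`. -/

namespace GradedClassical

open Matrix

/-! ### The involution on indices. -/

section Partner

variable {n : ℕ}

theorem partner_partner (hn : Even n) (i : Fin n) : partner (partner i) = i := by
  obtain ⟨m, rfl⟩ := hn
  apply Fin.ext
  have hi := i.isLt
  unfold partner
  split_ifs <;> simp_all <;> omega

theorem partner_ne (hn : Even n) (i : Fin n) : partner i ≠ i := by
  obtain ⟨m, rfl⟩ := hn
  intro h
  have h := congrArg Fin.val h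
  have hi := i.isLt
  unfold partner at h
  split_ifs at h <;> simp at h <;> omega

theorem partner_injective (hn : Even n) : Function.Injective (partner (n := n)) :=
  fun i j h => by rw [← partner_partner hn i, h, partner_partner hn]

theorem partner_mod_two (hn : Even n) (i : Fin n) :
    ((partner i : Fin n) : ℕ) % 2 = 0 ↔ ¬ (i : ℕ) % 2 = 0 := by
  obtain ⟨m, rfl⟩ := hn
  have hi := i.isLt
  unfold partner
  split_ifs <;> simp <;> omega

/-- The involution permutes indices inside blocks of consecutive ones, so it can only reverse the
order of two indices in the same block, which `h` excludes. Used to bring generators into the form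
with `i < j`. -/
theorem partner_lt_partner {i j : Fin n} (hij : j < i) (h : i ≠ partner j) :
    partner j < partner i := by
  have hi := i.isLt
  have hj := j.isLt
  rw [Fin.lt_def] at hij ⊢
  rw [Ne, Fin.ext_iff] at h
  unfold partner at h ⊢
  split_ifs at h ⊢ <;> simp at h ⊢ <;> omega

end Partner

/-! ### Bilinear forms and Siegel transformations. -/

section Forms

variable {n : ℕ} {R : Type*} [CommRing R]

/-- The sign `λ` with `⟨w, v⟩ = λ ⟨v, w⟩`. -/
def lam (R : Type*) [CommRing R] : Kind → R
  | .symplectic => -1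
  | _ => 1

/-- The non-zero entry of the `i`-th row of the Gram matrix. -/
def rowSign (R : Type*) [CommRing R] {n : ℕ} (c : Kind) (i : Fin n) : R :=
  match c with
  | .symplectic => if (i : ℕ) % 2 = 0 then 1 else -1
  | _ => 1

/-- The Gram matrix of the form; it equals `ψ` or `ψ̃`. -/
def gram (n : ℕ) (R : Type*) [CommRing R] (c : Kind) : Matrix (Fin n) (Fin n) R :=
  Matrix.of fun i j => if j = partner i then rowSign R c i else 0

/-- The bilinear form of the Gram matrix. -/
def inn (c : Kind) (v w : Fin n → R) : R := (v ᵥ* gram n R c) ⬝ᵥ w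

theorem lam_mul_lam (c : Kind) : lam R c * lam R c = 1 := by cases c <;> simp [lam]

theorem rowSign_eq (c : Kind) (i : Fin n) : rowSign R c i = 1 ∨ rowSign R c i = -1 := by
  cases c
  · simp [rowSign]
  · simp only [rowSign]; split_ifs <;> simp
  · simp [rowSign]

theorem rowSign_mul_self (c : Kind) (i : Fin n) : rowSign R c i * rowSign R c i = 1 := by
  rcases rowSign_eq (R := R) c i with h | h <;> rw [h] <;> ring

theorem rowSign_partner (hn : Even n) (c : Kind) (i : Fin n) :
    rowSign R c (partner i) = lam R c * rowSign R c i := by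
  cases c
  · simp [rowSign, lam]
  · have := partner_mod_two hn i
    simp only [rowSign, lam]
    split_ifs <;> simp_all
  · simp [rowSign, lam]

theorem vecMul_gram (hn : Even n) (c : Kind) (v : Fin n → R) (j : Fin n) :
    (v ᵥ* gram n R c) j = v (partner j) * rowSign R c (partner j) := by
  simp only [vecMul, dotProduct, gram, of_apply]
  rw [Finset.sum_eq_single (partner j)]
  · simp [partner_partner hn]
  · intro b _ hb
    rw [if_neg, mul_zero]
    rintro rfl
    exact hb (partner_partner hn b).symm
  · simp

theorem inn_add_left (c : Kind) (u v w : Fin n → R) : inn c (u + v) w = inn c u w + inn c v w := by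
  simp [inn, add_vecMul]

theorem inn_add_right (c : Kind) (u v w : Fin n → R) : inn c u (v + w) = inn c u v + inn c u w := by
  simp [inn]

theorem inn_smul_left (c : Kind) (a : R) (v w : Fin n → R) : inn c (a • v) w = a * inn c v w := by
  simp [inn, smul_vecMul]

theorem inn_smul_right (c : Kind) (a : R) (v w : Fin n → R) : inn c v (a • w) = a * inn c v w := by
  simp [inn]

theorem inn_sub_right (c : Kind) (u v w : Fin n → R) : inn c u (v - w) = inn c u v - inn c u w := by
  simp [inn]

theorem inn_sub_left (c : Kind) (u v w : Fin n → R) : inn c (u - v) w = inn c u w - inn c v w := by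
  simp [inn, sub_vecMul]

theorem inn_zero_left (c : Kind) (w : Fin n → R) : inn c 0 w = 0 := by simp [inn]

theorem inn_zero_right (c : Kind) (w : Fin n → R) : inn c w 0 = 0 := by simp [inn]

theorem inn_single_left (hn : Even n) (c : Kind) (p : Fin n) (x : Fin n → R) :
    inn c (Pi.single p 1) x = rowSign R c p * x (partner p) := by
  simp only [inn, dotProduct, vecMul_gram hn]
  rw [Finset.sum_eq_single (partner p)]
  · simp [partner_partner hn]
  · intro b _ hb
    rw [Pi.single_eq_of_ne, zero_mul, zero_mul]
    rintro rfl
    exact hb (partner_partner hn b).symm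
  · simp

theorem inn_symm (hn : Even n) (c : Kind) (v w : Fin n → R) : inn c w v = lam R c * inn c v w := by
  simp only [inn, dotProduct, vecMul_gram hn, Finset.mul_sum]
  refine Finset.sum_bij' (fun i _ => partner i) (fun i _ => partner i) ?_ ?_ ?_ ?_ ?_ <;>
    try simp [partner_partner hn]
  intro i
  rw [rowSign_partner hn]
  linear_combination (-w (partner i) * rowSign R c i * v i) * (lam_mul_lam (R := R) c) +
    w (partner i) * rowSign R c i * v i * (lam_mul_lam (R := R) c)

theorem inn_self_symplectic (hn : Even n) (v : Fin n → R) : inn .symplectic v v = 0 := by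
  simp only [inn, dotProduct, vecMul_gram hn]
  refine Finset.sum_involution (fun i _ => partner i) ?_ ?_ ?_ ?_
  · intro i _
    simp only [partner_partner hn, rowSign_partner hn, lam]
    ring
  · intro i _ _
    exact partner_ne hn i
  · simp
  · intro i _
    exact partner_partner hn i

/-- The matrix `1 + u w̃ - λ w ũ + Q u ũ`. -/
def siegel (c : Kind) (u w : Fin n → R) (Q : R) : Matrix (Fin n) (Fin n) R :=
  1 + vecMulVec u (w ᵥ* gram n R c) - lam R c • vecMulVec w (u ᵥ* gram n R c) +
    Q • vecMulVec u (u ᵥ* gram n R c)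

theorem siegel_mulVec (c : Kind) (u w : Fin n → R) (Q : R) (x : Fin n → R) :
    siegel c u w Q *ᵥ x = x + (inn c w x + Q * inn c u x) • u - (lam R c * inn c u x) • w := by
  ext i
  simp [siegel, add_mulVec, sub_mulVec, smul_mulVec, vecMulVec_mulVec, inn]
  ring

theorem matrix_ext_mulVec {P Q : Matrix (Fin n) (Fin n) R} (h : ∀ x, P *ᵥ x = Q *ᵥ x) : P = Q :=
  Matrix.mulVec_injective (funext h)

theorem siegel_zero (c : Kind) (u : Fin n → R) : siegel c u 0 0 = 1 := by simp [siegel]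

/-- For a fixed isotropic `u` these matrices multiply as in a Heisenberg group: the vectors add, and
the scalars add up to the cocycle `-λ⟨w, w'⟩`. -/
theorem siegel_mul_siegel (hn : Even n) (c : Kind) {u w w' : Fin n → R} (Q Q' : R) (hu : inn c u u = 0)
    (hw : inn c u w = 0) (hw' : inn c u w' = 0) :
    siegel c u w Q * siegel c u w' Q' = siegel c u (w + w') (Q + Q' - lam R c * inn c w w') := by
  have hw2 : inn c w u = 0 := by rw [inn_symm hn c u, hw, mul_zero]
  apply matrix_ext_mulVec
  intro x
  rw [← mulVec_mulVec]
  simp only [siegel_mulVec, inn_add_left, inn_add_right, inn_sub_right, inn_smul_right, hu, hw', hw2]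
  module

theorem siegel_mul_siegel_neg (hn : Even n) (c : Kind) {u w : Fin n → R} (Q : R) (hu : inn c u u = 0)
    (hw : inn c u w = 0) (hQ : (1 + lam R c) * Q + inn c w w = 0) :
    siegel c u w Q * siegel c u (-w) (lam R c * Q) = 1 := by
  have e : -w = (-1 : R) • w := by simp
  have h1 : inn c u (-w) = 0 := by rw [e, inn_smul_right, hw, mul_zero]
  rw [siegel_mul_siegel hn c _ _ hu hw h1, add_neg_cancel, e, inn_smul_right]
  convert siegel_zero c u using 2
  linear_combination lam R c * hQ + (- Q) * lam_mul_lam (R := R) c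

/-- The factor `(1 + λ) Q + ⟨w, w⟩` is the exact obstruction to being an isometry. It vanishes
automatically in the symplectic case and reads `2Q + ⟨w, w⟩` in the orthogonal one. The formula is
also read backwards, to deduce its vanishing. -/
theorem inn_siegel (hn : Even n) (c : Kind) {u w : Fin n → R} {Q : R} (hu : inn c u u = 0)
    (hw : inn c u w = 0) (x y : Fin n → R) :
    inn c (siegel c u w Q *ᵥ x) (siegel c u w Q *ᵥ y) =
      inn c x y + inn c u x * inn c u y * ((1 + lam R c) * Q + inn c w w) := by
  have hw2 : inn c w u = 0 := by rw [inn_symm hn c u, hw, mul_zero]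
  simp only [siegel_mulVec, inn_add_left, inn_add_right, inn_sub_right, inn_sub_left, inn_smul_right,
    inn_smul_left, hu, hw, hw2]
  rw [inn_symm hn c u x, inn_symm hn c w x]
  linear_combination (- inn c w x * inn c u y + inn c u x * inn c u y * inn c w w) *
    lam_mul_lam (R := R) c

theorem siegel_smul_left (c : Kind) (a : R) (u w : Fin n → R) (Q : R) :
    siegel c (a • u) w Q = siegel c u (a • w) (a * a * Q) := by
  apply matrix_ext_mulVec
  intro x
  simp only [siegel_mulVec, inn_smul_left]
  module

theorem siegel_swap (c : Kind) (u w : Fin n → R) : siegel c u w 0 = siegel c w (-lam R c • u) 0 := by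
  apply matrix_ext_mulVec
  intro x
  simp only [siegel_mulVec, inn_smul_left]
  rw [zero_mul, zero_mul, add_zero, add_zero, smul_smul,
    show lam R c * inn c w x * -lam R c = -(lam R c * lam R c * inn c w x) by ring, lam_mul_lam]
  module

/-- `g` preserves the form. -/
def PreservesInn (c : Kind) (g : Matrix (Fin n) (Fin n) R) : Prop :=
  ∀ x y, inn c (g *ᵥ x) (g *ᵥ y) = inn c x y

theorem preservesInn_siegel (hn : Even n) (c : Kind) {u w : Fin n → R} {Q : R} (hu : inn c u u = 0)
    (hw : inn c u w = 0) (hQ : (1 + lam R c) * Q + inn c w w = 0) : PreservesInn c (siegel c u w Q) := by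
  intro x y
  rw [inn_siegel hn c hu hw, hQ, mul_zero, add_zero]

theorem siegel_conj {c : Kind} {g : Matrix (Fin n) (Fin n) R} (hg : PreservesInn c g)
    (u w : Fin n → R) (Q : R) : g * siegel c u w Q = siegel c (g *ᵥ u) (g *ᵥ w) Q * g := by
  apply matrix_ext_mulVec
  intro x
  rw [← mulVec_mulVec, ← mulVec_mulVec]
  simp only [siegel_mulVec, mulVec_add, mulVec_sub, mulVec_smul, hg _ _]

end Forms

/-! ### Elementary matrices with controlled parameters. -/

section Elementary

variable {n : ℕ} {R : Type*} [CommRing R]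

/-- The standard basis vectors. -/
def bv (R : Type*) [CommRing R] {n : ℕ} (i : Fin n) : Fin n → R := Pi.single i 1

/-- Elementary matrices with parameter `z`, expressed through `siegel` for the non-linear groups. -/
inductive Elem (c : Kind) : R → Matrix (Fin n) (Fin n) R → Prop
  | lin (h : c = .linear) (i j : Fin n) (hij : i ≠ j) (z : R) : Elem c z (1 + Matrix.single i j z)
  | short (h : c ≠ .linear) (p q : Fin n) (h₁ : q ≠ p) (h₂ : q ≠ partner p) (z : R) :
      Elem c z (siegel c (bv R p) (z • bv R q) 0)
  | long (h : c = .symplectic) (p : Fin n) (z : R) : Elem c z (siegel c (bv R p) 0 z)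

/-- The subgroup generated by the elementary matrices with parameter in `W`. -/
def elemGroup (c : Kind) (n : ℕ) (W : Set R) : Subgroup (GL (Fin n) R) :=
  Subgroup.closure {g | ∃ z ∈ W, Elem c z (g : Matrix (Fin n) (Fin n) R)}

/-- The matrix `P` belongs to `elemGroup c n W`. -/
def MemElem (c : Kind) (W : Set R) (P : Matrix (Fin n) (Fin n) R) : Prop :=
  ∃ g ∈ elemGroup c n W, (g : Matrix (Fin n) (Fin n) R) = P

theorem MemElem.mul {c : Kind} {W : Set R} {P Q : Matrix (Fin n) (Fin n) R} (hP : MemElem c W P)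
    (hQ : MemElem c W Q) : MemElem c W (P * Q) := by
  obtain ⟨g, hg, rfl⟩ := hP
  obtain ⟨h, hh, rfl⟩ := hQ
  exact ⟨g * h, mul_mem hg hh, rfl⟩

theorem MemElem.one (c : Kind) (W : Set R) : MemElem c W (1 : Matrix (Fin n) (Fin n) R) :=
  ⟨1, one_mem _, rfl⟩

theorem MemElem.mem {c : Kind} {W : Set R} {g : GL (Fin n) R}
    (h : MemElem c W (g : Matrix (Fin n) (Fin n) R)) : g ∈ elemGroup c n W := by
  obtain ⟨g', hg', h⟩ := h
  rwa [← Units.ext h]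

theorem inn_single_single (hn : Even n) (c : Kind) (p q : Fin n) :
    inn c (bv R p) (bv R q) = if q = partner p then rowSign R c p else 0 := by
  rw [bv, inn_single_left hn, bv]
  split_ifs with h
  · rw [h, Pi.single_eq_same, mul_one]
  · rw [Pi.single_eq_of_ne (Ne.symm h), mul_zero]

theorem Kind.Admissible.even {c : Kind} (hc : c.Admissible n) (h : c ≠ .linear) : Even n := by
  cases c
  · exact absurd rfl h
  · exact hc.1
  · exact hc.1

theorem Kind.Admissible.six_le {c : Kind} (hc : c.Admissible n) (h : c ≠ .linear) : 6 ≤ n := by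
  cases c
  · exact absurd rfl h
  · exact hc.2
  · exact hc.2

theorem Elem.exists_inv {c : Kind} (hc : c.Admissible n) {z : R} {P : Matrix (Fin n) (Fin n) R}
    (h : Elem c z P) : ∃ Q, Elem c (-z) Q ∧ P * Q = 1 := by
  cases h with
  | lin h i j hij =>
    refine ⟨_, .lin h i j hij _, ?_⟩
    simp [mul_add, add_mul, Matrix.single_mul_single_of_ne, hij.symm, ← Matrix.single_add,
      add_assoc]
  | short h p q h₁ h₂ =>
    have hn := hc.even h
    refine ⟨_, .short h p q h₁ h₂ _, ?_⟩
    have := siegel_mul_siegel_neg (R := R) hn c (u := bv R p) (w := z • bv R q) 0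
      (by rw [inn_single_single hn, if_neg (partner_ne hn p).symm])
      (by rw [inn_smul_right, inn_single_single hn, if_neg h₂, mul_zero])
      (by rw [inn_smul_right, inn_smul_left, inn_single_single hn, if_neg (partner_ne hn q).symm]
          ring)
    rwa [mul_zero, ← neg_smul] at this
  | long h p =>
    subst h
    have hn := hc.1
    refine ⟨_, .long rfl p _, ?_⟩
    have := siegel_mul_siegel_neg (R := R) hn .symplectic (u := bv R p) (w := 0) z
      (by rw [inn_single_single hn, if_neg (partner_ne hn p).symm])
      (inn_zero_right _ _)
      (by rw [inn_zero_right]; simp [lam])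
    simpa [lam] using this

theorem Elem.exists_gl {c : Kind} (hc : c.Admissible n) {z : R} {P : Matrix (Fin n) (Fin n) R}
    (h : Elem c z P) : ∃ g : GL (Fin n) R, (g : Matrix (Fin n) (Fin n) R) = P := by
  obtain ⟨Q, -, hQ⟩ := h.exists_inv hc
  exact ⟨⟨P, Q, hQ, mul_eq_one_comm.mp hQ⟩, rfl⟩

theorem Elem.memElem {c : Kind} (hc : c.Admissible n) {W : Set R} {z : R}
    {P : Matrix (Fin n) (Fin n) R} (h : Elem c z P) (hz : z ∈ W) : MemElem c W P := by
  obtain ⟨g, rfl⟩ := h.exists_gl hc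
  exact ⟨g, Subgroup.subset_closure ⟨z, hz, h⟩, rfl⟩

theorem Elem.inv {c : Kind} (hc : c.Admissible n) {z : R} {g : GL (Fin n) R}
    (h : Elem c z (g : Matrix (Fin n) (Fin n) R)) :
    Elem c (-z) ((g⁻¹ : GL (Fin n) R) : Matrix (Fin n) (Fin n) R) := by
  obtain ⟨Q, hQ, hQ'⟩ := h.exists_inv hc
  have : ((g⁻¹ : GL (Fin n) R) : Matrix (Fin n) (Fin n) R) = Q := Units.inv_eq_of_mul_eq_one_right hQ'
  rwa [this]

theorem Elem.preservesInn {c : Kind} (hc : c.Admissible n) (hl : c ≠ .linear) {z : R}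
    {P : Matrix (Fin n) (Fin n) R} (h : Elem c z P) : PreservesInn c P := by
  have hn := hc.even hl
  cases h with
  | lin h i j hij => exact absurd h hl
  | short h p q h₁ h₂ =>
    refine preservesInn_siegel hn c ?_ ?_ ?_
    · rw [inn_single_single hn, if_neg (partner_ne hn p).symm]
    · rw [inn_smul_right, inn_single_single hn, if_neg h₂, mul_zero]
    · rw [inn_smul_right, inn_smul_left, inn_single_single hn, if_neg (partner_ne hn q).symm]
      ring
  | long h p =>
    subst h
    refine preservesInn_siegel hn _ ?_ (inn_zero_right _ _) ?_
    · rw [inn_single_single hn, if_neg (partner_ne hn p).symm]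
    · rw [inn_zero_right]; simp [lam]

/-! ### Conjugation in general position, non-linear cases. -/

section Conj

variable {c : Kind} {W : NonUnitalSubring R}

theorem siegel_single_fix (hn : Even n) (c : Kind) {k l x : Fin n} (r : R) (h₁ : x ≠ partner k)
    (h₂ : x ≠ partner l) :
    siegel c (bv R k) (r • bv R l) 0 *ᵥ bv R x = bv R x := by
  simp [siegel_mulVec, inn_smul_left, inn_single_single hn, h₁, h₂]

theorem siegel_single_move (hn : Even n) (c : Kind) {k l : Fin n} (r : R) (h : k ≠ l) :
    siegel c (bv R k) (r • bv R l) 0 *ᵥ bv R (partner l) =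
      bv R (partner l) + (r * rowSign R c l) • bv R k := by
  simp [siegel_mulVec, inn_smul_left, inn_single_single hn, (partner_injective hn).ne h.symm]

theorem siegel_long_fix (hn : Even n) (c : Kind) {k x : Fin n} (r : R) (h₁ : x ≠ partner k) :
    siegel c (bv R k) 0 r *ᵥ bv R x = bv R x := by
  simp [siegel_mulVec, inn_zero_left, inn_single_single hn, h₁]

theorem siegel_long_move (hn : Even n) (c : Kind) {k : Fin n} (r : R) :
    siegel c (bv R k) 0 r *ᵥ bv R (partner k) =
      bv R (partner k) + (r * rowSign R c k) • bv R k := by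
  simp [siegel_mulVec, inn_zero_left, inn_single_single hn]

theorem rowSign_mul_mem (c : Kind) (i : Fin n) {z : R} (hz : z ∈ W) : z * rowSign R c i ∈ W := by
  rcases rowSign_eq (R := R) c i with h | h <;> rw [h] <;> simpa using hz

theorem lam_mul_mem (c : Kind) {z : R} (hz : z ∈ W) : z * lam R c ∈ W := by
  cases c <;> simpa [lam] using hz

theorem siegel_single_swap (c : Kind) (p q : Fin n) (z : R) :
    siegel c (bv R p) (z • bv R q) 0 =
      siegel c (bv R q) ((-(z * lam R c)) • bv R p) 0 := by
  rw [siegel_swap, siegel_smul_left, smul_smul]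
  congr 1
  · congr 1; ring
  · ring

theorem siegel_single_self (c : Kind) (p : Fin n) (z : R) :
    siegel c (bv R p) (z • bv R p) 0 =
      siegel c (bv R p) 0 ((1 - lam R c) * z) := by
  apply matrix_ext_mulVec
  intro x
  simp only [siegel_mulVec, inn_smul_left, inn_zero_left]
  module

/-- The degenerate case `q = p` is harmless: it gives a long generator with parameter `2z` in the
symplectic case and the identity in the orthogonal one. -/
theorem memElem_siegel_single (hc : c.Admissible n) (hl : c ≠ .linear) {p q : Fin n}
    (h : q ≠ partner p) {z : R} (hz : z ∈ W) :
    MemElem c (W : Set R) (siegel c (bv R p) (z • bv R q) 0) := by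
  rcases eq_or_ne q p with rfl | hqp
  · rw [siegel_single_self]
    cases c
    · exact absurd rfl hl
    · refine (Elem.long rfl _ _).memElem hc ?_
      simp only [lam]
      have : (1 - -1) * z = z + z := by ring
      rw [this]
      exact W.add_mem hz hz
    · simp [lam, siegel_zero, MemElem.one]
  · exact (Elem.short hl p q hqp h z).memElem hc hz

/-- The Heisenberg law splits the vector into its two summands. The correction is nonzero only if `k
= σ(q)`, which `h₃` confines to the symplectic case, where it is a long generator; its parameter is
in `W` because `W` is closed under products. -/
theorem memElem_siegel_add (hc : c.Admissible n) (hl : c ≠ .linear) {p q k : Fin n}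
    (h₁ : q ≠ partner p) (h₂ : k ≠ partner p) (h₃ : c = .symplectic ∨ k ≠ partner q) {z a : R}
    (hz : z ∈ W) (hza : z * a ∈ W) :
    MemElem c (W : Set R)
      (siegel c (bv R p) (z • (bv R q + a • bv R k)) 0) := by
  have hn := hc.even hl
  have hp : inn c (bv R p) (bv R p) = 0 := by
    rw [inn_single_single hn, if_neg (partner_ne hn p).symm]
  have hq : inn c (bv R p) (z • bv R q) = 0 := by
    rw [inn_smul_right, inn_single_single hn, if_neg h₁, mul_zero]
  have hk : inn c (bv R p) ((z * a) • bv R k) = 0 := by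
    rw [inn_smul_right, inn_single_single hn, if_neg h₂, mul_zero]
  have e : siegel c (bv R p) (z • (bv R q + a • bv R k)) 0 =
      siegel c (bv R p) (z • bv R q) 0 *
      siegel c (bv R p) ((z * a) • bv R k) 0 *
      siegel c (bv R p) 0
        (lam R c * inn c (z • bv R q) ((z * a) • bv R k)) := by
    rw [siegel_mul_siegel hn c _ _ hp hq hk, siegel_mul_siegel hn c _ _ hp _ (inn_zero_right _ _),
      smul_add, smul_smul, add_zero, inn_zero_right]
    · congr 1; ring
    · rw [inn_add_right, hq, hk, add_zero]
  rw [e]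
  refine ((memElem_siegel_single hc hl h₁ hz).mul (memElem_siegel_single hc hl h₂ hza)).mul ?_
  rw [inn_smul_left, inn_smul_right, inn_single_single hn]
  split_ifs with h
  · have hs := h₃.resolve_right (not_not.mpr h)
    refine (Elem.long hs _ _).memElem hc ?_
    have := lam_mul_mem c (rowSign_mul_mem c q (W.mul_mem hz hza))
    rw [SetLike.mem_coe]
    refine cast (congrArg (· ∈ W) ?_) this
    ring
  · rw [mul_zero, mul_zero, mul_zero, siegel_zero]
    exact MemElem.one _ _

theorem siegel_conj_gl {g : GL (Fin n) R} (hg : PreservesInn c (g : Matrix (Fin n) (Fin n) R))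
    (u w : Fin n → R) (Q : R) :
    (g : Matrix (Fin n) (Fin n) R) * siegel c u w Q * ((g⁻¹ : GL (Fin n) R) : Matrix _ _ R) =
      siegel c ((g : Matrix (Fin n) (Fin n) R) *ᵥ u) ((g : Matrix (Fin n) (Fin n) R) *ᵥ w) Q := by
  rw [siegel_conj hg, Matrix.mul_assoc, ← Units.val_mul, mul_inv_cancel, Units.val_one,
    Matrix.mul_one]

/-- `g P g⁻¹` lies in the elementary group with parameters in `W`. -/
def ConjMem (c : Kind) (W : Set R) (g : GL (Fin n) R) (P : Matrix (Fin n) (Fin n) R) : Prop :=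
  MemElem c W ((g : Matrix (Fin n) (Fin n) R) * P * ((g⁻¹ : GL (Fin n) R) : Matrix _ _ R))

theorem ConjMem.mul {W : Set R} {g : GL (Fin n) R} {P Q : Matrix (Fin n) (Fin n) R}
    (hP : ConjMem c W g P) (hQ : ConjMem c W g Q) : ConjMem c W g (P * Q) := by
  have := MemElem.mul hP hQ
  unfold ConjMem
  convert this using 1
  simp only [Matrix.mul_assoc]
  rw [← Matrix.mul_assoc _ (g : Matrix (Fin n) (Fin n) R), ← Units.val_mul, inv_mul_cancel,
    Units.val_one, Matrix.one_mul]

/-- `g` fixes all basis vectors except those with index `s` and `t`, which are moved as by an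
elementary matrix with parameter `r`. -/
def Moves (c : Kind) (r : R) (g : Matrix (Fin n) (Fin n) R) (s t : Fin n) : Prop :=
  (∀ x, x ≠ s → x ≠ t → g *ᵥ bv R x = bv R x) ∧
  (∃ a, (a = r ∨ a = -r) ∧ g *ᵥ bv R s = bv R s + a • bv R (partner t)) ∧
  (∃ a, (a = r ∨ a = -r) ∧ g *ᵥ bv R t = bv R t + a • bv R (partner s)) ∧
  t ≠ partner s ∧ (s = t → c = .symplectic)

theorem Moves.symm (hn : Even n) {r : R} {g : Matrix (Fin n) (Fin n) R} {s t : Fin n}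
    (h : Moves c r g s t) : Moves c r g t s :=
  ⟨fun x h₁ h₂ => h.1 x h₂ h₁, h.2.2.1, h.2.1,
    fun e => h.2.2.2.1 (by rw [e, partner_partner hn]), fun e => h.2.2.2.2 e.symm⟩

theorem mul_rowSign_eq (c : Kind) (r : R) (k : Fin n) :
    r * rowSign R c k = r ∨ r * rowSign R c k = -r := by
  rcases rowSign_eq (R := R) c k with h | h <;> rw [h] <;> simp

/-- Only the action on basis vectors matters below, so short and long generators are treated alike;
long ones give `s = t`. -/
theorem Elem.exists_moves (hc : c.Admissible n) (hl : c ≠ .linear) {r : R}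
    {g : Matrix (Fin n) (Fin n) R} (hg : Elem c r g) : ∃ s t, Moves c r g s t := by
  have hn := hc.even hl
  cases hg with
  | lin h => exact absurd h hl
  | short h k l hlk hlk' =>
    refine ⟨partner l, partner k, fun x h₁ h₂ => siegel_single_fix hn c r h₂ h₁, ?_, ?_, ?_, ?_⟩
    · refine ⟨_, mul_rowSign_eq c r l, ?_⟩
      rw [siegel_single_move hn c r hlk.symm, partner_partner hn]
    · refine ⟨_, ?_, by rw [siegel_single_swap, siegel_single_move hn c _ hlk, partner_partner hn]⟩
      rcases mul_rowSign_eq c (-(r * lam R c)) k with h | h <;> rw [h] <;>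
        cases c <;> simp [lam]
    · rw [partner_partner hn]; exact hlk'.symm
    · exact fun e => absurd (partner_injective hn e) hlk
  | long h k =>
    refine ⟨partner k, partner k, fun x h₁ _ => siegel_long_fix hn c r h₁, ?_, ?_, ?_, fun _ => h⟩
    · exact ⟨_, mul_rowSign_eq c r k, by rw [siegel_long_move hn, partner_partner hn]⟩
    · exact ⟨_, mul_rowSign_eq c r k, by rw [siegel_long_move hn, partner_partner hn]⟩
    · exact (partner_ne hn _).symm

theorem neg_or_mul_mem {a r z : R} (ha : a = r ∨ a = -r) (h : r * z ∈ W) : z * a ∈ W := by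
  rcases ha with rfl | rfl
  · rwa [mul_comm]
  · rw [mul_neg, mul_comm]; exact W.neg_mem h

/-- Conjugation by an isometry applies `g` to both vectors. As `g` fixes `e_p`, the only change is
that `e_q` may acquire a multiple of one further basis vector. -/
theorem conjMem_short_of_fix (hc : c.Admissible n) (hl : c ≠ .linear) {g : GL (Fin n) R} {r : R}
    (hg : PreservesInn c (g : Matrix (Fin n) (Fin n) R)) {s t : Fin n}
    (hm : Moves c r (g : Matrix (Fin n) (Fin n) R) s t) {p q : Fin n}
    (hs : p ≠ s) (ht : p ≠ t) (h₁ : q ≠ partner p) {z : R} (hz : z ∈ W) (hrz : r * z ∈ W) :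
    ConjMem c (W : Set R) g (siegel c (bv R p) (z • bv R q) 0) := by
  have hn := hc.even hl
  unfold ConjMem
  rw [siegel_conj_gl hg, mulVec_smul, hm.1 p hs ht]
  have key : ∀ s t : Fin n, Moves c r (g : Matrix (Fin n) (Fin n) R) s t → p ≠ t → q = s →
      MemElem c (W : Set R) (siegel c (bv R p) (z • (g : Matrix (Fin n) (Fin n) R) *ᵥ bv R q) 0) := by
    rintro s t hm ht rfl
    obtain ⟨-, ⟨a, ha, e⟩, -, -, h⟩ := hm
    rw [e]
    refine memElem_siegel_add hc hl h₁ ((partner_injective hn).ne ht.symm) ?_ hz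
      (neg_or_mul_mem ha hrz)
    by_cases hst : q = t
    · exact .inl (h hst)
    · exact .inr ((partner_injective hn).ne (Ne.symm hst))
  by_cases hqs : q = s
  · exact key s t hm ht hqs
  by_cases hqt : q = t
  · exact key t s (hm.symm hn) hs hqt
  rw [hm.1 q hqs hqt]
  exact memElem_siegel_single hc hl h₁ hz

theorem conjMem_short_of_ne (hc : c.Admissible n) (hl : c ≠ .linear) {g : GL (Fin n) R} {r : R}
    (hg : PreservesInn c (g : Matrix (Fin n) (Fin n) R)) {s t : Fin n}
    (hm : Moves c r (g : Matrix (Fin n) (Fin n) R) s t) {p q : Fin n}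
    (h : (p ≠ s ∧ p ≠ t) ∨ (q ≠ s ∧ q ≠ t)) (h₁ : q ≠ partner p) {z : R} (hz : z ∈ W)
    (hrz : r * z ∈ W) :
    ConjMem c (W : Set R) g (siegel c (bv R p) (z • bv R q) 0) := by
  have hn := hc.even hl
  rcases h with h | h
  · exact conjMem_short_of_fix hc hl hg hm h.1 h.2 h₁ hz hrz
  · rw [siegel_single_swap]
    refine conjMem_short_of_fix hc hl hg hm h.1 h.2 (fun e => h₁ ?_) ?_ ?_
    · rw [e, partner_partner hn]
    · exact W.neg_mem (lam_mul_mem c hz)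
    · have := W.neg_mem (lam_mul_mem c hrz)
      rwa [mul_neg, ← mul_assoc]

/-- Expansion of the rank-one term `z u ũ` at `u = e_p + a e_k`: the mixed terms form a short
generator and the square terms two long ones. -/
theorem siegel_add_long (hn : Even n) {p k : Fin n} (h : k ≠ partner p) (a z : R) :
    siegel .symplectic (bv R p + a • bv R k) 0 z =
      siegel .symplectic (bv R p) ((a * z) • bv R k) 0 * siegel .symplectic (bv R p) 0 z *
        siegel .symplectic (bv R k) 0 (a * (a * z)) := by
  apply matrix_ext_mulVec
  intro x
  have h' : p ≠ partner k := fun e => h (by rw [e, partner_partner hn])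
  simp only [← mulVec_mulVec]
  simp only [siegel_mulVec, inn_add_left, inn_smul_left, inn_add_right, inn_sub_right,
    inn_smul_right, inn_zero_left, inn_zero_right, inn_single_single hn, if_neg h, if_neg h',
    if_neg (partner_ne hn p).symm, if_neg (partner_ne hn k).symm, lam]
  module

theorem conjMem_long_of_ne (hc : c.Admissible n) (hl : c = .symplectic) {g : GL (Fin n) R} {r : R}
    (hg : PreservesInn c (g : Matrix (Fin n) (Fin n) R)) {s t : Fin n}
    (hm : Moves c r (g : Matrix (Fin n) (Fin n) R) s t) {p : Fin n}
    (h : ¬ (p = s ∧ p = t)) {z : R} (hz : z ∈ W)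
    (hrz : r * z ∈ W) (hrrz : r * (r * z) ∈ W) :
    ConjMem c (W : Set R) g (siegel c (bv R p) 0 z) := by
  subst hl
  have hn := hc.1
  unfold ConjMem
  rw [siegel_conj_gl hg, mulVec_zero]
  have key : ∀ s t : Fin n, Moves .symplectic r (g : Matrix (Fin n) (Fin n) R) s t → p ≠ t →
      p = s → MemElem .symplectic (W : Set R)
        (siegel .symplectic ((g : Matrix (Fin n) (Fin n) R) *ᵥ bv R p) 0 z) := by
    rintro s t hm ht rfl
    obtain ⟨-, ⟨a, ha, e⟩, -, -, -⟩ := hm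
    have hne := (partner_injective hn).ne ht.symm
    rw [e, siegel_add_long hn hne]
    refine ((memElem_siegel_single hc (by simp) hne ?_).mul
      ((Elem.long rfl _ _).memElem hc hz)).mul ((Elem.long rfl _ _).memElem hc ?_)
    · rw [mul_comm]; exact neg_or_mul_mem ha hrz
    · rcases ha with rfl | rfl
      · exact hrrz
      · simpa using hrrz
  by_cases hs : p = s
  · exact key s t hm (fun e => h ⟨hs, e⟩) hs
  · by_cases ht : p = t
    · exact key t s (hm.symm hn) hs ht
    · rw [hm.1 p hs ht]
      exact (Elem.long rfl _ _).memElem hc hz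

end Conj

end Elementary

/-! ### Conjugation of opposite generators through commutator formulas. -/

section ConjOpposite

variable {n : ℕ} {R : Type*} [CommRing R] {c : Kind} {W : NonUnitalSubring R}

theorem exists_notMem_of_six_le (hn : 6 ≤ n) (p q p' q' : Fin n) :
    ∃ k : Fin n, k ≠ p ∧ k ≠ q ∧ k ≠ p' ∧ k ≠ q' := by
  obtain ⟨k, hk⟩ : ∃ k, k ∉ ({p, q, p', q'} : Finset (Fin n)) := by
    by_contra! h
    have h1 : ({p, q, p', q'} : Finset (Fin n)) = Finset.univ := Finset.eq_univ_of_forall h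
    have h2 : ({p, q, p', q'} : Finset (Fin n)).card ≤ 4 := Finset.card_le_four
    rw [h1, Finset.card_univ, Fintype.card_fin] at h2
    omega
  simp only [Finset.mem_insert, Finset.mem_singleton, not_or] at hk
  exact ⟨k, hk⟩

theorem short_mul_neg (hn : Even n) {p q : Fin n} (h : q ≠ partner p) (z : R) :
    siegel c (bv R p) (z • bv R q) 0 * siegel c (bv R p) ((-z) • bv R q) 0 = 1 := by
  rw [siegel_mul_siegel hn c]
  · rw [← add_smul, add_neg_cancel, zero_smul, inn_smul_left, inn_smul_right, inn_single_single hn,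
      if_neg (partner_ne hn q).symm, mul_zero, mul_zero, mul_zero, add_zero, sub_zero, siegel_zero]
  · rw [inn_single_single hn, if_neg (partner_ne hn p).symm]
  · rw [inn_smul_right, inn_single_single hn, if_neg h, mul_zero]
  · rw [inn_smul_right, inn_single_single hn, if_neg h, mul_zero]

theorem short_neg_mul (hn : Even n) {p q : Fin n} (h : q ≠ partner p) (z : R) :
    siegel c (bv R p) ((-z) • bv R q) 0 * siegel c (bv R p) (z • bv R q) 0 = 1 := by
  have := short_mul_neg (c := c) hn h (-z)
  rwa [neg_neg] at this

theorem preservesInn_short (hn : Even n) {p q : Fin n} (h : q ≠ partner p) (z : R) :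
    PreservesInn c (siegel c (bv R p) (z • bv R q) 0) := by
  refine preservesInn_siegel hn c ?_ ?_ ?_
  · rw [inn_single_single hn, if_neg (partner_ne hn p).symm]
  · rw [inn_smul_right, inn_single_single hn, if_neg h, mul_zero]
  · rw [inn_smul_right, inn_smul_left, inn_single_single hn, if_neg (partner_ne hn q).symm]
    ring

/-- A Chevalley commutator formula through an auxiliary index `k`. Conjugation by the generator on
`(p, k)` turns `e_{σ(k)}` into `e_{σ(k)}` plus a multiple of `e_p`; the factor with `-z` then
removes the old part. -/
theorem short_eq_commutator (hn : Even n) {p q k : Fin n} (h : q ≠ partner p)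
    (h₁ : k ≠ p) (h₂ : k ≠ q) (h₃ : k ≠ partner p) (h₄ : k ≠ partner q) (t z : R) :
    siegel c (bv R q) ((z * (t * rowSign R c k)) • bv R p) 0 =
      siegel c (bv R q) ((-z) • bv R (partner k)) 0 * (siegel c (bv R p) (t • bv R k) 0 *
        siegel c (bv R q) (z • bv R (partner k)) 0 * siegel c (bv R p) ((-t) • bv R k) 0) := by
  have hinj := partner_injective hn
  have h' : p ≠ partner q := fun e => h (by rw [e, partner_partner hn])
  have hk : partner k ≠ p := fun e => h₃ (by rw [← e, partner_partner hn])
  rw [siegel_conj (preservesInn_short hn h₃ t), mulVec_smul, siegel_single_move hn c t h₁.symm,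
    siegel_single_fix hn c t h (fun e => h₄ (by rw [e, partner_partner hn])), Matrix.mul_assoc,
    short_mul_neg hn h₃, Matrix.mul_one, siegel_mul_siegel hn]
  · congr 1
    · module
    · rw [smul_add, smul_smul, inn_add_right, inn_smul_left, inn_smul_left, inn_smul_right,
        inn_smul_right, inn_single_single hn, inn_single_single hn, partner_partner hn,
        if_neg h₁.symm, if_neg (partner_ne hn k)]
      ring
  · rw [inn_single_single hn, if_neg (partner_ne hn q).symm]
  · rw [inn_smul_right, inn_single_single hn, if_neg (hinj.ne h₂), mul_zero]
  · rw [inn_smul_right, inn_add_right, inn_smul_right, inn_single_single hn, inn_single_single hn,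
      if_neg (hinj.ne h₂), if_neg h', mul_zero, add_zero, mul_zero]

/-- The bad case is that `g` moves both `e_p` and `e_q`; it then moves nothing else. Every factor of
the commutator formula involves `k` or `σ(k)`, which avoid `p` and `q`, so each factor is in general
position. The price is a parameter that is a product. -/
theorem conjMem_short (hc : c.Admissible n) (hl : c ≠ .linear) {g : GL (Fin n) R} {r : R}
    (hg : Elem c r (g : Matrix (Fin n) (Fin n) R)) {p q : Fin n}
    (h₀ : q ≠ p) (h : q ≠ partner p) {t z : R} (ht : t ∈ W) (hrt : r * t ∈ W)
    (hz : z ∈ W) (hrz : r * z ∈ W) :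
    ConjMem c (W : Set R) g (siegel c (bv R q) ((z * t) • bv R p) 0) := by
  have hn := hc.even hl
  have hinj := partner_injective hn
  have hP := hg.preservesInn hc hl
  obtain ⟨s, s', hm⟩ := hg.exists_moves hc hl
  have h' : p ≠ partner q := fun e => h (by rw [e, partner_partner hn])
  by_cases hop : (q ≠ s ∧ q ≠ s') ∨ (p ≠ s ∧ p ≠ s')
  · refine conjMem_short_of_ne hc hl hP hm hop h' (W.mul_mem hz ht) ?_
    rw [← mul_assoc]
    exact W.mul_mem hrz ht
  obtain ⟨k, h₁, h₂, h₃, h₄⟩ := exists_notMem_of_six_le (hc.six_le hl) p q (partner p) (partner q)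
  have hpk : partner k ≠ p := fun e => h₃ (by rw [← e, partner_partner hn])
  have hqk : partner k ≠ q := fun e => h₄ (by rw [← e, partner_partner hn])
  -- Here `{s, s'} = {p, q}`, because `p ≠ q` and both are moved.
  have hks : ∀ k : Fin n, k ≠ p → k ≠ q → k ≠ s ∧ k ≠ s' := by
    intro k hp hq
    constructor
    · rintro rfl; grind
    · rintro rfl; grind
  have e : z * t = z * (t * rowSign R c k * rowSign R c k) := by
    rw [mul_assoc t, rowSign_mul_self, mul_one]
  rw [e, short_eq_commutator hn h h₁ h₂ h₃ h₄]
  have htk : t * rowSign R c k ∈ W := rowSign_mul_mem c k ht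
  have hrtk : r * (t * rowSign R c k) ∈ W := by
    rw [← mul_assoc]; exact rowSign_mul_mem c k hrt
  refine ConjMem.mul ?_ (ConjMem.mul (ConjMem.mul ?_ ?_) ?_)
  · refine conjMem_short_of_ne hc hl hP hm (.inr (hks _ hpk hqk)) (hinj.ne h₂) (W.neg_mem hz) ?_
    rw [mul_neg]; exact W.neg_mem hrz
  · exact conjMem_short_of_ne hc hl hP hm (.inr (hks _ h₁ h₂)) h₃ htk hrtk
  · exact conjMem_short_of_ne hc hl hP hm (.inr (hks _ hpk hqk)) (hinj.ne h₂) hz hrz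
  · refine conjMem_short_of_ne hc hl hP hm (.inr (hks _ h₁ h₂)) h₃ (W.neg_mem htk) ?_
    rw [mul_neg]; exact W.neg_mem hrtk

theorem long_neg_mul (hn : Even n) (p : Fin n) (z : R) :
    siegel c (bv R p) 0 (-z) * siegel c (bv R p) 0 z = 1 := by
  have h : inn c (bv R p) (bv R p) = 0 := by
    rw [inn_single_single hn, if_neg (partner_ne hn p).symm]
  rw [siegel_mul_siegel hn c _ _ h (inn_zero_right _ _) (inn_zero_right _ _), inn_zero_right]
  simp [siegel_zero]

/-- Conjugating the long generator at `σ(k)` spreads it over `e_{σ(k)}` and `e_p`. Cancelling the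
long part at `σ(k)` and the mixed short part leaves the long generator at `p`, with parameter
quadratic in `t`. -/
theorem long_eq_commutator (hn : Even n) {p k : Fin n} (h₁ : k ≠ p) (h₃ : k ≠ partner p) (t z : R) :
    siegel .symplectic (bv R p) 0 (t * (t * z)) =
      siegel .symplectic (bv R (partner k)) 0 (-z) *
        (siegel .symplectic (bv R (partner k))
            ((-(t * rowSign R .symplectic k * z)) • bv R p) 0 *
        (siegel .symplectic (bv R p) (t • bv R k) 0 *
        siegel .symplectic (bv R (partner k)) 0 z *
        siegel .symplectic (bv R p) ((-t) • bv R k) 0)) := by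
  have hpk : p ≠ partner (partner k) := by rw [partner_partner hn]; exact h₁.symm
  rw [siegel_conj (preservesInn_short hn h₃ t), siegel_single_move hn _ t h₁.symm, mulVec_zero,
    Matrix.mul_assoc _ _ (siegel .symplectic (bv R p) ((-t) • bv R k) 0),
    short_mul_neg hn h₃, Matrix.mul_one, siegel_add_long hn hpk, Matrix.mul_assoc _ _
    (siegel .symplectic (bv R p) 0 _), ← Matrix.mul_assoc (siegel _ _ (-_ • _) _),
    short_neg_mul hn hpk, Matrix.one_mul, ← Matrix.mul_assoc, long_neg_mul hn, Matrix.one_mul]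
  congr 1
  linear_combination (-(t * t * z)) * rowSign_mul_self (R := R) .symplectic k

theorem conjMem_long (hc : c.Admissible n) (hl : c = .symplectic) {g : GL (Fin n) R} {r : R}
    (hg : Elem c r (g : Matrix (Fin n) (Fin n) R)) {p : Fin n} {t z : R}
    (ht : t ∈ W) (hrt : r * t ∈ W)
    (hz : z ∈ W) (hrz : r * z ∈ W) (hrrz : r * (r * z) ∈ W) :
    ConjMem c (W : Set R) g (siegel c (bv R p) 0 (t * (t * z))) := by
  subst hl
  have hn := hc.1
  have hl : Kind.symplectic ≠ .linear := by simp
  have hP := hg.preservesInn hc hl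
  obtain ⟨s, s', hm⟩ := hg.exists_moves hc hl
  obtain ⟨k, h₁, -, h₃, -⟩ := exists_notMem_of_six_le (hc.six_le hl) p p (partner p) (partner p)
  have hpk' : partner k ≠ p := fun e => h₃ (by rw [← e, partner_partner hn])
  have hpk : p ≠ partner (partner k) := by rw [partner_partner hn]; exact h₁.symm
  by_cases hop : ¬ (p = s ∧ p = s')
  · refine conjMem_long_of_ne hc rfl hP hm hop (W.mul_mem ht (W.mul_mem ht hz)) ?_ ?_
    · rw [← mul_assoc]; exact W.mul_mem hrt (W.mul_mem ht hz)
    · have := W.mul_mem hrt (W.mul_mem hrt hz)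
      refine cast (congrArg (· ∈ W) ?_) this
      ring
  rw [not_not] at hop
  obtain ⟨rfl, rfl⟩ := hop
  rw [long_eq_commutator hn h₁ h₃]
  have htz : t * rowSign R .symplectic k * z ∈ W := W.mul_mem (rowSign_mul_mem _ k ht) hz
  refine ConjMem.mul ?_ (ConjMem.mul ?_ (ConjMem.mul (ConjMem.mul ?_ ?_) ?_))
  · refine conjMem_long_of_ne hc rfl hP hm (fun h => hpk' h.1) (W.neg_mem hz) ?_ ?_
    · rw [mul_neg]; exact W.neg_mem hrz
    · rw [mul_neg, mul_neg]; exact W.neg_mem hrrz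
  · refine conjMem_short_of_ne hc hl hP hm (.inl ⟨hpk', hpk'⟩) hpk (W.neg_mem htz) ?_
    have := W.neg_mem (W.mul_mem (rowSign_mul_mem (c := .symplectic) k hrt) hz)
    refine cast (congrArg (· ∈ W) ?_) this
    ring
  · exact conjMem_short_of_ne hc hl hP hm (.inr ⟨h₁, h₁⟩) h₃ ht hrt
  · exact conjMem_long_of_ne hc rfl hP hm (fun h => hpk' h.1) hz hrz hrrz
  · refine conjMem_short_of_ne hc hl hP hm (.inr ⟨h₁, h₁⟩) h₃ (W.neg_mem ht) ?_
    rw [mul_neg]; exact W.neg_mem hrt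

theorem conjMem_of_mul_eq {g : GL (Fin n) R} {P P' : Matrix (Fin n) (Fin n) R}
    (h : (g : Matrix (Fin n) (Fin n) R) * P = P' * g) (hP : MemElem c (W : Set R) P') :
    ConjMem c (W : Set R) g P := by
  unfold ConjMem
  rwa [h, Matrix.mul_assoc, ← Units.val_mul, mul_inv_cancel, Units.val_one, Matrix.mul_one]

theorem single_neg_eq (i j : Fin n) (z : R) : Matrix.single i j (-z) = -Matrix.single i j z := by
  rw [eq_neg_iff_add_eq_zero, ← Matrix.single_add, neg_add_cancel, Matrix.single_zero]

/-- Unless the two positions are opposite, at most one of the products `e_{kl} e_{ij}` and `e_{ij}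
e_{kl}` survives, and the conjugate gains at most one further elementary factor. -/
theorem conjMem_lin_of_ne (hc : Kind.linear.Admissible n) {g : GL (Fin n) R} {r : R} {k l : Fin n}
    (hkl : k ≠ l) (hg : (g : Matrix (Fin n) (Fin n) R) = 1 + Matrix.single k l r)
    {i j : Fin n} (hij : i ≠ j) (h : ¬ (l = i ∧ k = j)) {z : R} (hz : z ∈ W) (hrz : r * z ∈ W) :
    ConjMem .linear (W : Set R) g (1 + Matrix.single i j z) := by
  have hE : ∀ i j : Fin n, i ≠ j → ∀ z ∈ W, MemElem .linear (W : Set R) (1 + Matrix.single i j z) :=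
    fun i j h z hz => (Elem.lin rfl i j h z).memElem hc hz
  by_cases hli : l = i
  · subst hli
    have hkj : k ≠ j := fun e => h ⟨rfl, e⟩
    refine conjMem_of_mul_eq ?_ ((hE l j hij z hz).mul (hE k j hkj _ hrz))
    rw [hg]
    simp [mul_add, add_mul, Matrix.single_mul_single_of_ne, hkj.symm]
    abel
  · by_cases hkj : k = j
    · subst hkj
      have hmem : -(z * r) ∈ W := by rw [mul_comm]; exact W.neg_mem hrz
      refine conjMem_of_mul_eq ?_ ((hE i k hij z hz).mul (hE i l (Ne.symm hli) _ hmem))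
      rw [hg]
      simp [mul_add, add_mul, Matrix.single_mul_single_of_ne, hli, hij.symm, hkl.symm, single_neg_eq]
      abel
    · refine conjMem_of_mul_eq ?_ (hE i j hij z hz)
      rw [hg]
      simp [mul_add, add_mul, Matrix.single_mul_single_of_ne, hli, Ne.symm hkj]
      abel

theorem lin_eq_commutator {i j m : Fin n} (hij : i ≠ j) (hi : m ≠ i) (hj : m ≠ j) (t z : R) :
    (1 : Matrix (Fin n) (Fin n) R) + Matrix.single i j (t * z) =
      (1 + Matrix.single i m t) * (1 + Matrix.single m j z) * (1 + Matrix.single i m (-t)) *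
        (1 + Matrix.single m j (-z)) := by
  simp [mul_add, add_mul, Matrix.single_mul_single_of_ne, hij.symm, hi, hj.symm, single_neg_eq]
  abel

theorem conjMem_lin (hc : Kind.linear.Admissible n) {g : GL (Fin n) R} {r : R}
    (hg : Elem .linear r (g : Matrix (Fin n) (Fin n) R)) {i j : Fin n} (hij : i ≠ j) {t z : R}
    (ht : t ∈ W) (hrt : r * t ∈ W) (hz : z ∈ W) (hrz : r * z ∈ W) :
    ConjMem .linear (W : Set R) g (1 + Matrix.single i j (t * z)) := by
  generalize hG : (g : Matrix (Fin n) (Fin n) R) = G at hg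
  cases hg with
  | short h => exact absurd rfl h
  | long h => cases h
  | lin h k l hkl =>
    obtain ⟨m, hi, hj⟩ : ∃ m : Fin n, m ≠ i ∧ m ≠ j := by
      obtain ⟨m, hm⟩ : ∃ m, m ∉ ({i, j} : Finset (Fin n)) := by
        by_contra! h
        have h1 : ({i, j} : Finset (Fin n)) = Finset.univ := Finset.eq_univ_of_forall h
        have h2 : ({i, j} : Finset (Fin n)).card ≤ 2 := Finset.card_le_two
        rw [h1, Finset.card_univ, Fintype.card_fin] at h2
        have : 3 ≤ n := hc
        omega
      simp only [Finset.mem_insert, Finset.mem_singleton, not_or] at hm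
      exact ⟨m, hm⟩
    by_cases h : l = i ∧ k = j
    · obtain ⟨rfl, rfl⟩ := h
      rw [lin_eq_commutator hij hi hj]
      refine ConjMem.mul (ConjMem.mul (ConjMem.mul ?_ ?_) ?_) ?_
      · exact conjMem_lin_of_ne hc hkl hG hi.symm (fun h => hj h.2.symm) ht hrt
      · exact conjMem_lin_of_ne hc hkl hG hj (fun h => hi h.1.symm) hz hrz
      · refine conjMem_lin_of_ne hc hkl hG hi.symm (fun h => hj h.2.symm) (W.neg_mem ht) ?_
        rw [mul_neg]; exact W.neg_mem hrt
      · refine conjMem_lin_of_ne hc hkl hG hj (fun h => hi h.1.symm) (W.neg_mem hz) ?_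
        rw [mul_neg]; exact W.neg_mem hrz
    · refine conjMem_lin_of_ne hc hkl hG hij h (W.mul_mem ht hz) ?_
      rw [← mul_assoc]
      exact W.mul_mem hrt hz

/-- Conjugating an elementary matrix with sufficiently divisible parameter by an elementary matrix
with parameter `r` gives an element of the elementary group with parameters in `W`. -/
theorem conjMem_elem (hc : c.Admissible n) {g : GL (Fin n) R} {r : R}
    (hg : Elem c r (g : Matrix (Fin n) (Fin n) R)) {t z : R} (ht : t ∈ W) (hrt : r * t ∈ W)
    (hz : z ∈ W) (hrz : r * z ∈ W) (hrrz : r * (r * z) ∈ W) {P : Matrix (Fin n) (Fin n) R}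
    (hP : Elem c (t * (t * z)) P) : ConjMem c (W : Set R) g P := by
  generalize hw : t * (t * z) = w at hP
  have htz : r * (t * z) ∈ W := by rw [← mul_assoc]; exact W.mul_mem hrt hz
  cases hP with
  | lin h i j hij =>
    subst h hw
    exact conjMem_lin hc hg hij ht hrt (W.mul_mem ht hz) htz
  | short h p q h₁ h₂ =>
    subst hw
    have hn := hc.even h
    exact conjMem_short hc h hg h₁.symm
      (fun e => h₂ (by rw [e, partner_partner hn])) (W.mul_mem ht hz) htz ht hrt
  | long h p =>
    subst hw
    exact conjMem_long hc h hg ht hrt hz hrz hrrz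

end ConjOpposite

/-! ### Behaviour under ring homomorphisms and comparison with the given generators. -/

section Functoriality

variable {n : ℕ} {R R' : Type*} [CommRing R] [CommRing R'] {c : Kind}

theorem map_rowSign (φ : R →+* R') (c : Kind) (i : Fin n) : φ (rowSign R c i) = rowSign R' c i := by
  cases c <;> simp only [rowSign, map_one]
  split_ifs <;> simp

theorem map_lam (φ : R →+* R') (c : Kind) : φ (lam R c) = lam R' c := by
  cases c <;> simp [lam]

theorem gram_map (φ : R →+* R') (c : Kind) : (gram n R c).map φ = gram n R' c := by
  ext i j
  simp only [gram, map_apply, of_apply]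
  split_ifs <;> simp [map_rowSign]

theorem bv_map (φ : R →+* R') (i : Fin n) : φ ∘ bv R i = bv R' i := by
  ext j
  simp [bv, Pi.single_apply, apply_ite φ]

theorem siegel_map (φ : R →+* R') (c : Kind) (u w : Fin n → R) (Q : R) :
    (siegel c u w Q).map φ = siegel c (φ ∘ u) (φ ∘ w) (φ Q) := by
  have h : ∀ v : Fin n → R, ∀ j, φ ((v ᵥ* gram n R c) j) = ((φ ∘ v) ᵥ* gram n R' c) j := by
    intro v j
    rw [← gram_map φ, RingHom.map_vecMul]
  ext i j
  simp [siegel, vecMulVec_apply, Matrix.one_apply, map_lam, h, apply_ite φ]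

theorem smul_bv_map (φ : R →+* R') (z : R) (i : Fin n) : φ ∘ (z • bv R i) = φ z • bv R' i := by
  rw [← bv_map φ]; ext j; simp

theorem Elem.map (φ : R →+* R') {z : R} {P : Matrix (Fin n) (Fin n) R} (h : Elem c z P) :
    Elem c (φ z) (P.map φ) := by
  cases h with
  | lin h i j hij =>
    convert Elem.lin h i j hij (φ z) using 1
    ext i j
    simp [Matrix.one_apply, Matrix.single_apply, apply_ite φ]
  | short h p q h₁ h₂ =>
    rw [siegel_map, bv_map, smul_bv_map, map_zero]
    exact .short h p q h₁ h₂ _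
  | long h p =>
    rw [siegel_map, bv_map, show φ ∘ (0 : Fin n → R) = 0 by ext; simp]
    exact .long h p _

/-- Elementary matrices of a fixed shape are additive in their parameter, so two images of one
differ by an elementary matrix whose parameter is the difference. -/
theorem Elem.exists_map_eq (hc : c.Admissible n) (φ ψ : R →+* R') {z : R}
    {P : Matrix (Fin n) (Fin n) R} (h : Elem c z P) :
    ∃ Q, Elem c (φ z - ψ z) Q ∧ P.map φ = Q * P.map ψ := by
  cases h with
  | lin h i j hij =>
    refine ⟨_, .lin h i j hij _, ?_⟩
    have e : ∀ φ : R →+* R', (1 + Matrix.single i j z).map φ = 1 + Matrix.single i j (φ z) := by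
      intro φ
      ext i j
      simp [Matrix.one_apply, Matrix.single_apply, apply_ite φ]
    rw [e, e]
    simp [mul_add, add_mul, Matrix.single_mul_single_of_ne, hij.symm, add_assoc,
      ← Matrix.single_add]
  | short h p q h₁ h₂ =>
    have hn := hc.even h
    refine ⟨_, .short h p q h₁ h₂ _, ?_⟩
    rw [siegel_map, siegel_map, bv_map, bv_map, smul_bv_map, smul_bv_map, map_zero, map_zero,
      siegel_mul_siegel hn, ← add_smul, sub_add_cancel]
    · simp [inn_smul_left, inn_smul_right, inn_single_single hn, (partner_ne hn q).symm]
    · simp [inn_single_single hn, (partner_ne hn p).symm]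
    · simp [inn_smul_right, inn_single_single hn, h₂]
    · simp [inn_smul_right, inn_single_single hn, h₂]
  | long h p =>
    subst h
    have hn := hc.1
    refine ⟨_, .long rfl p _, ?_⟩
    have e : ∀ φ : R →+* R', φ ∘ (0 : Fin n → R) = 0 := by intro φ; ext; simp
    rw [siegel_map, siegel_map, bv_map, bv_map, e, e, siegel_mul_siegel hn]
    · simp [inn_zero_left]
    · simp [inn_single_single hn, (partner_ne hn p).symm]
    · simp [inn_zero_right]
    · simp [inn_zero_right]

theorem map_mem_elemGroup (φ : R →+* R') {W : Set R} {g : GL (Fin n) R}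
    (hg : g ∈ elemGroup c n W) : GeneralLinearGroup.map φ g ∈ elemGroup c n (φ '' W) := by
  induction hg using Subgroup.closure_induction with
  | mem g hg =>
    obtain ⟨z, hz, h⟩ := hg
    exact Subgroup.subset_closure ⟨φ z, ⟨z, hz, rfl⟩, h.map φ⟩
  | one => rw [map_one]; exact one_mem _
  | mul g h _ _ ihg ihh => rw [map_mul]; exact mul_mem ihg ihh
  | inv g _ ih => rw [map_inv]; exact inv_mem ih

theorem exists_map_eq_of_mem_elemGroup (hc : c.Admissible n) (φ : R →+* R') {W : Set R}
    {g : GL (Fin n) R'} (hg : g ∈ elemGroup c n (φ '' W)) :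
    ∃ h ∈ elemGroup c n W, GeneralLinearGroup.map φ h = g := by
  induction hg using Subgroup.closure_induction with
  | mem g hg =>
    obtain ⟨_, ⟨z, hz, rfl⟩, h⟩ := hg
    have key : ∀ Q : Matrix (Fin n) (Fin n) R', Elem c (φ z) Q → ∃ P, Elem c z P ∧ P.map φ = Q := by
      intro Q h
      generalize hw : φ z = w at h
      cases h with
      | lin h i j hij =>
        subst hw
        refine ⟨_, .lin h i j hij z, ?_⟩
        ext i j
        simp [Matrix.one_apply, Matrix.single_apply, apply_ite φ]
      | short h p q h₁ h₂ =>
        subst hw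
        exact ⟨_, .short h p q h₁ h₂ z, by rw [siegel_map, bv_map, smul_bv_map, map_zero]⟩
      | long h p =>
        subst hw
        exact ⟨_, .long h p z, by
          rw [siegel_map, bv_map, show φ ∘ (0 : Fin n → R) = 0 by ext; simp]⟩
    obtain ⟨P, hP, hPg⟩ := key _ h
    obtain ⟨g', rfl⟩ := hP.exists_gl hc
    exact ⟨g', Subgroup.subset_closure ⟨z, hz, hP⟩, Units.ext hPg⟩
  | one => exact ⟨1, one_mem _, map_one _⟩
  | mul g h _ _ ihg ihh =>
    obtain ⟨g', hg', rfl⟩ := ihg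
    obtain ⟨h', hh', rfl⟩ := ihh
    exact ⟨g' * h', mul_mem hg' hh', map_mul _ _ _⟩
  | inv g _ ih =>
    obtain ⟨g', hg', rfl⟩ := ih
    exact ⟨g'⁻¹, inv_mem hg', map_inv _ _⟩

theorem elem_zero_eq_one {P : Matrix (Fin n) (Fin n) R} (h : Elem c 0 P) : P = 1 := by
  generalize hz : (0 : R) = z at h
  cases h with
  | lin h i j hij => subst hz; simp
  | short h p q h₁ h₂ => subst hz; rw [zero_smul, siegel_zero]
  | long h p => subst hz; rw [siegel_zero]

theorem map_eq_one_of_mem_elemGroup (φ : R →+* R') {W : Set R} (hW : ∀ z ∈ W, φ z = 0)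
    {g : GL (Fin n) R} (hg : g ∈ elemGroup c n W) : GeneralLinearGroup.map φ g = 1 := by
  have : elemGroup c n W ≤ (GeneralLinearGroup.map (n := Fin n) φ).ker := by
    refine (Subgroup.closure_le _).mpr ?_
    rintro g ⟨z, hz, h⟩
    have := h.map φ
    rw [hW z hz] at this
    exact Units.ext (elem_zero_eq_one this)
  exact this hg

theorem bv_vecMul_gram (hn : Even n) (c : Kind) (p : Fin n) :
    bv R p ᵥ* gram n R c = rowSign R c p • bv R (partner p) := by
  ext j
  rw [vecMul_gram hn]
  by_cases h : partner p = j
  · subst h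
    simp [bv, partner_partner hn]
  · have h' : p ≠ partner j := fun e => h (by rw [e, partner_partner hn])
    simp [bv, h'.symm, Ne.symm h]

theorem vecMulVec_bv (i j : Fin n) : vecMulVec (bv R i) (bv R j) = Matrix.single i j 1 := by
  ext k l
  by_cases h : i = k <;> by_cases h' : j = l <;>
    simp [bv, vecMulVec_apply, h, h', eq_comm]

theorem siegel_short_eq (hn : Even n) (p q : Fin n) (z : R) :
    siegel c (bv R p) (z • bv R q) 0 = 1 + Matrix.single p (partner q) (z * rowSign R c q) -
      Matrix.single q (partner p) (lam R c * z * rowSign R c p) := by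
  simp only [siegel, smul_vecMul, bv_vecMul_gram hn, vecMulVec_smul, smul_vecMulVec, vecMulVec_bv,
    Matrix.smul_single, smul_smul, zero_smul, add_zero, smul_eq_mul, mul_one, mul_assoc]
  ring_nf

theorem siegel_long_eq (hn : Even n) (p : Fin n) (z : R) :
    siegel c (bv R p) 0 z = 1 + Matrix.single p (partner p) (z * rowSign R c p) := by
  simp [siegel, bv_vecMul_gram hn, vecMulVec_smul, vecMulVec_bv, Matrix.smul_single]

theorem rowSign_mul_symplectic (i j : Fin n) :
    rowSign R .symplectic i * rowSign R .symplectic j = (-1) ^ ((i : ℕ) + (j : ℕ)) := by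
  have h : ∀ i : Fin n, rowSign R .symplectic i = (-1) ^ (i : ℕ) := by
    intro i
    simp only [rowSign]
    split_ifs with h
    · rw [Even.neg_one_pow (Nat.even_iff.mpr h)]
    · rw [Odd.neg_one_pow (Nat.odd_iff.mpr (by omega))]
  rw [h, h, pow_add]

theorem IsElementaryGenerator.exists_elem (hc : c.Admissible n) {P : Matrix (Fin n) (Fin n) R}
    (h : IsElementaryGenerator c P) : ∃ z, Elem c z P := by
  have key : ∀ hl : c ≠ .linear, ∀ (i j : Fin n) (z : R), i < j → i ≠ partner j →
      ∃ w, Elem c w (1 + Matrix.single i j z -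
        Matrix.single (partner j) (partner i) (rowSign R c i * rowSign R c j * z)) := by
    intro hl i j z hij h
    have hn := hc.even hl
    -- The sign cancels the one coming from the row of the Gram matrix, as signs square to `1`.
    refine ⟨z * rowSign R c (partner j), ?_⟩
    convert Elem.short hl i (partner j) h.symm ((partner_injective hn).ne hij.ne').symm.symm
      (z * rowSign R c (partner j)) using 1
    rw [siegel_short_eq hn, partner_partner hn, mul_assoc z, rowSign_mul_self, mul_one,
      rowSign_partner hn]
    congr 2
    linear_combination (-(rowSign R c i * rowSign R c j * z)) * lam_mul_lam (R := R) c
  cases c with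
  | linear =>
    obtain ⟨i, j, z, hij, rfl⟩ := h
    exact ⟨z, .lin rfl i j hij z⟩
  | symplectic =>
    have hn := hc.1
    rcases h with ⟨i, j, z, -, rfl, rfl⟩ | ⟨i, j, z, hij, h, rfl⟩
    · refine ⟨z * rowSign R .symplectic (partner j), ?_⟩
      convert Elem.long rfl (partner j) (z * rowSign R .symplectic (partner j)) using 1
      rw [siegel_long_eq hn, partner_partner hn, mul_assoc, rowSign_mul_self, mul_one]
    · rw [← rowSign_mul_symplectic]
      exact key (by simp) i j z hij h
  | orthogonal =>
    obtain ⟨i, j, z, hij, h, rfl⟩ := h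
    simpa [rowSign] using key (by simp) i j z hij h

theorem Elem.isElementaryGenerator (hc : c.Admissible n) {z : R} {P : Matrix (Fin n) (Fin n) R}
    (h : Elem c z P) : IsElementaryGenerator c P := by
  have key : ∀ hl : c ≠ .linear, ∀ (p q : Fin n) (z : R), q ≠ p → q ≠ partner p →
      ∃ (i j : Fin n) (w : R), i < j ∧ i ≠ partner j ∧ siegel c (bv R p) (z • bv R q) 0 =
        1 + Matrix.single i j w -
        Matrix.single (partner j) (partner i) (rowSign R c i * rowSign R c j * w) := by
    intro hl p q z h₁ h₂
    have hn := hc.even hl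
    have hll := lam_mul_lam (R := R) c
    rw [siegel_short_eq hn]
    -- The two off-diagonal entries sit at `(p, σ(q))` and `(q, σ(p))`. Exactly one of the
    -- trichotomy's outer cases makes the first lie above the diagonal; in the other the second
    -- does, and they exchange roles.
    rcases lt_trichotomy p (partner q) with h | h | h
    · refine ⟨p, partner q, z * rowSign R c q, h, ?_, ?_⟩
      · rw [partner_partner hn]; exact h₁.symm
      · rw [partner_partner hn, rowSign_partner hn]
        congr 2
        linear_combination (-(lam R c * rowSign R c p * z)) * rowSign_mul_self (R := R) c q
    · exact absurd (by rw [h, partner_partner hn]) h₂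
    · have hlt : q < partner p := by
        have := partner_lt_partner h (by rw [partner_partner hn]; exact h₁.symm)
        rwa [partner_partner hn] at this
      refine ⟨q, partner p, -(lam R c * z * rowSign R c p), hlt, ?_, ?_⟩
      · rw [partner_partner hn]; exact h₁
      · rw [partner_partner hn, rowSign_partner hn, single_neg_eq]
        have e : rowSign R c q * (lam R c * rowSign R c p) * -(lam R c * z * rowSign R c p) =
            -(z * rowSign R c q) := by
          linear_combination (-(z * rowSign R c q * rowSign R c p * rowSign R c p)) * hll -
            z * rowSign R c q * rowSign_mul_self (R := R) c p
        rw [e, single_neg_eq]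
        abel
  cases h with
  | lin h i j hij =>
    subst h
    exact ⟨i, j, _, hij, rfl⟩
  | short h p q h₁ h₂ =>
    obtain ⟨i, j, w, hij, h', e⟩ := key h p q _ h₁ h₂
    rw [e]
    cases c with
    | linear => exact absurd rfl h
    | symplectic =>
      rw [rowSign_mul_symplectic]
      exact .inr ⟨i, j, w, hij, h', rfl⟩
    | orthogonal => exact ⟨i, j, w, hij, h', by simp [rowSign]⟩
  | long h p =>
    subst h
    have hn := hc.1
    exact .inl ⟨p, partner p, _, (partner_ne hn p).symm, (partner_partner hn p).symm,
      siegel_long_eq hn p _⟩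

theorem E_eq_elemGroup (hc : c.Admissible n) : E n R c = elemGroup c n Set.univ := by
  unfold E elemGroup
  congr 1
  ext g
  exact ⟨fun h => (h.exists_elem hc).imp fun z hz => ⟨trivial, hz⟩,
    fun ⟨_, _, h⟩ => h.isElementaryGenerator hc⟩

theorem map_mem_E (hc : c.Admissible n) (φ : R →+* R') {g : GL (Fin n) R} (hg : g ∈ E n R c) :
    GeneralLinearGroup.map φ g ∈ E n R' c := by
  rw [E_eq_elemGroup hc] at hg ⊢
  exact Subgroup.closure_mono (by rintro x ⟨z, -, hx⟩; exact ⟨z, trivial, hx⟩)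
    (map_mem_elemGroup φ hg)

end Functoriality

theorem map_map_eq {n : ℕ} {R R₁ R₂ R₃ : Type*} [CommRing R] [CommRing R₁] [CommRing R₂]
    [CommRing R₃] {φ : R →+* R₁} {ψ : R₁ →+* R₃} {φ' : R →+* R₂} {ψ' : R₂ →+* R₃}
    (h : ψ.comp φ = ψ'.comp φ') (g : GL (Fin n) R) :
    GeneralLinearGroup.map ψ (GeneralLinearGroup.map φ g) =
      GeneralLinearGroup.map ψ' (GeneralLinearGroup.map φ' g) :=
  Units.ext (Matrix.ext fun i j => DFunLike.congr_fun h (g i j))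

/-! ### Uniform continuity of conjugation and descent from a localization. -/

section Dilation

variable {n : ℕ} {c : Kind} {A : Type*} [CommRing A] (S : Submonoid A) {C : Type*} [CommRing C]
  [Algebra A C]

/-- The image of the ideal generated by `m` in the algebra `C`. -/
def level (C : Type*) [CommRing C] [Algebra A C] (m : A) : NonUnitalSubring C where
  carrier := {x | ∃ a, x = algebraMap A C (m * a)}
  add_mem' := by
    rintro _ _ ⟨a, rfl⟩ ⟨b, rfl⟩
    exact ⟨a + b, by rw [mul_add, map_add]⟩
  zero_mem' := ⟨0, by simp⟩
  mul_mem' := by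
    rintro _ _ ⟨a, rfl⟩ ⟨b, rfl⟩
    exact ⟨a * (m * b), by rw [← map_mul]; ring_nf⟩
  neg_mem' := by
    rintro _ ⟨a, rfl⟩
    exact ⟨-a, by rw [mul_neg, map_neg]⟩

/-- With `d` a denominator of `r`, the parameter is split as `t · t · z` with `t = d m` and `z = d²
m a`: one factor `d` absorbs `r` in `r t`, two absorb `r²` in `r² z`. -/
theorem conj_mem_level_of_elem (hc : c.Admissible n) {g : GL (Fin n) C} {r : C}
    (hg : Elem c r (g : Matrix (Fin n) (Fin n) C)) {d b : A}
    (hd : algebraMap A C d * r = algebraMap A C b) (m : A) {x : GL (Fin n) C}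
    (hx : x ∈ elemGroup c n (level C ((d * m) * ((d * m) * (d * (d * m)))) : Set C)) :
    g * x * g⁻¹ ∈ elemGroup c n (level C m : Set C) := by
  have key : elemGroup c n (level C ((d * m) * ((d * m) * (d * (d * m)))) : Set C) ≤
      (elemGroup c n (level C m : Set C)).comap (MulAut.conj g).toMonoidHom := by
    refine (Subgroup.closure_le _).mpr ?_
    rintro x ⟨_, ⟨a, rfl⟩, hx⟩
    have e : algebraMap A C ((d * m) * ((d * m) * (d * (d * m))) * a) =
        algebraMap A C (d * m) * (algebraMap A C (d * m) * algebraMap A C (d * (d * m) * a)) := by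
      simp only [← map_mul]; ring_nf
    rw [e] at hx
    refine MemElem.mem (conjMem_elem (W := level C m) hc hg ?_ ?_ ?_ ?_ ?_ hx)
    · exact ⟨d, by rw [mul_comm]⟩
    · exact ⟨b, by rw [map_mul, map_mul, ← hd]; ring⟩
    · exact ⟨d * d * a, by ring_nf⟩
    · exact ⟨d * b * a, by simp only [map_mul, ← hd]; ring⟩
    · exact ⟨b * b * a, by simp only [map_mul, ← hd]; ring⟩
  exact key hx

/-- Evaluation of polynomials over `C` at elements of `A`. -/
noncomputable def evalAt (C : Type*) [CommRing C] [Algebra A C] (y : A) : C[X] →+* C :=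
  Polynomial.evalRingHom (algebraMap A C y)


/-- Conjugation by all specializations of `g` is uniformly continuous for the filtration by
levels. -/
def UniformConj (c : Kind) (S : Submonoid A) (g : GL (Fin n) C[X]) : Prop :=
  ∀ m ∈ S, ∃ k ∈ S, ∀ y : A, ∀ x ∈ elemGroup c n (level C k : Set C),
    GeneralLinearGroup.map (evalAt C y) g * x * (GeneralLinearGroup.map (evalAt C y) g)⁻¹ ∈
      elemGroup c n (level C m : Set C)

/-- Specializations of `g` at sufficiently close elements are close to each other. -/
def UniformDiff (c : Kind) (S : Submonoid A) (g : GL (Fin n) C[X]) : Prop :=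
  ∀ m ∈ S, ∃ k ∈ S, ∀ y x : A, GeneralLinearGroup.map (evalAt C (y + k * x)) g *
    (GeneralLinearGroup.map (evalAt C y) g)⁻¹ ∈ elemGroup c n (level C m : Set C)

theorem UniformConj.mul {g h : GL (Fin n) C[X]} (hg : UniformConj c S g)
    (hh : UniformConj c S h) : UniformConj c S (g * h) := by
  intro m hm
  obtain ⟨k, hk, hgk⟩ := hg m hm
  obtain ⟨l, hl, hhl⟩ := hh k hk
  refine ⟨l, hl, fun y x hx => ?_⟩
  have := hgk y _ (hhl y x hx)
  rw [map_mul, _root_.mul_inv_rev]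
  simpa only [mul_assoc] using this

/-- With `y' = y + l l' x`, the quotient for `g h` is `g(y') g(y)⁻¹` times the conjugate by `g(y)`
of `h(y') h(y)⁻¹`. Uniform conjugation controls the second factor. -/
theorem UniformDiff.mul {g h : GL (Fin n) C[X]} (hg : UniformDiff c S g)
    (hg' : UniformConj c S g) (hh : UniformDiff c S h) : UniformDiff c S (g * h) := by
  intro m hm
  obtain ⟨k, hk, hgk⟩ := hg' m hm
  obtain ⟨l, hl, hhl⟩ := hh k hk
  obtain ⟨l', hl', hgl⟩ := hg m hm
  refine ⟨l * l', S.mul_mem hl hl', fun y x => ?_⟩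
  have h₁ := hgk y _ (hhl y (l' * x))
  have h₂ := hgl y (l * x)
  rw [← mul_assoc] at h₁
  rw [← mul_assoc, mul_comm l'] at h₂
  have := mul_mem h₂ h₁
  rw [map_mul, map_mul, _root_.mul_inv_rev]
  simpa only [mul_assoc, inv_mul_cancel_left] using this

/-- `g(y')⁻¹ g(y)` is the conjugate by `g(y)⁻¹` of the inverse of `g(y') g(y)⁻¹`. -/
theorem UniformDiff.inv {g : GL (Fin n) C[X]} (hg : UniformDiff c S g)
    (hg' : UniformConj c S g⁻¹) : UniformDiff c S g⁻¹ := by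
  intro m hm
  obtain ⟨k, hk, hgk⟩ := hg' m hm
  obtain ⟨l, hl, hgl⟩ := hg k hk
  refine ⟨l, hl, fun y x => ?_⟩
  have := hgk y _ (inv_mem (hgl y x))
  rw [map_inv] at this
  rw [map_inv, map_inv]
  simpa only [_root_.mul_inv_rev, inv_inv, mul_assoc, inv_mul_cancel_left, inv_mul_cancel, mul_one] using this

variable [IsLocalization S C]

/-- Clearing the denominators of all coefficients at once gives one `d` for every evaluation point;
this is the source of uniformity in `y`. -/
theorem exists_integral (f : C[X]) : ∃ d ∈ S, ∃ F : A[X], ∀ y : A,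
    algebraMap A C d * evalAt C y f = algebraMap A C (F.eval y) := by
  obtain ⟨d, hd, h⟩ := IsLocalization.integerNormalization_spec S f
  refine ⟨d, hd, IsLocalization.integerNormalization S f, fun y => ?_⟩
  have := congrArg (evalAt C y) h
  simp only [evalAt, Polynomial.coe_evalRingHom, Polynomial.eval_map_algebraMap,
    Polynomial.aeval_algebraMap_apply, Polynomial.eval_smul] at this ⊢
  rw [← Algebra.smul_def, ← this]
  simp

theorem uniformConj_of_elem (hc : c.Admissible n) {g : GL (Fin n) C[X]} {f : C[X]}
    (hg : Elem c f (g : Matrix (Fin n) (Fin n) C[X])) : UniformConj c S g := by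
  obtain ⟨d, hd, F, hF⟩ := exists_integral S f
  intro m hm
  have hdm := S.mul_mem hd hm
  refine ⟨_, S.mul_mem hdm (S.mul_mem hdm (S.mul_mem hd hdm)), fun y x hx => ?_⟩
  exact conj_mem_level_of_elem hc (hg.map (evalAt C y)) (hF y) m hx

theorem uniformDiff_of_elem (hc : c.Admissible n) {g : GL (Fin n) C[X]} {f : C[X]}
    (hg : Elem c f (g : Matrix (Fin n) (Fin n) C[X])) : UniformDiff c S g := by
  obtain ⟨d, hd, F, hF⟩ := exists_integral S f
  intro m hm
  refine ⟨_, S.mul_mem hd hm, fun y x => ?_⟩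
  obtain ⟨Q, hQ, h⟩ := hg.exists_map_eq hc (evalAt C (y + d * m * x)) (evalAt C y)
  -- The values of `F` differ by a multiple of `d m x`; dividing by the denominator `d` leaves a
  -- multiple of `m`.
  obtain ⟨q, hq⟩ := Polynomial.sub_dvd_eval_sub (y + d * m * x) y F
  have hmem : evalAt C (y + d * m * x) f - evalAt C y f ∈ level C m := by
    refine ⟨x * q, (IsLocalization.map_units C (⟨d, hd⟩ : S)).mul_left_cancel ?_⟩
    change algebraMap A C d * _ = algebraMap A C d * _
    rw [mul_sub, hF, hF, ← map_sub, hq, ← map_mul]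
    congr 1
    ring
  obtain ⟨Q', hQ', rfl⟩ := hQ.memElem hc hmem
  have e : GeneralLinearGroup.map (evalAt C (y + d * m * x)) g =
      Q' * GeneralLinearGroup.map (evalAt C y) g := Units.ext h
  rw [e, mul_inv_cancel_right]
  exact hQ'

/-- Induction over the generators. The conjugation property of `g⁻¹` is carried along because it
does not follow formally from that of `g`. -/
theorem uniform_of_mem (hc : c.Admissible n) {g : GL (Fin n) C[X]} (hg : g ∈ E n C[X] c) :
    UniformConj c S g ∧ UniformConj c S g⁻¹ ∧ UniformDiff c S g := by
  rw [E_eq_elemGroup hc] at hg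
  induction hg using Subgroup.closure_induction with
  | mem g hg =>
    obtain ⟨f, -, hf⟩ := hg
    exact ⟨uniformConj_of_elem S hc hf, uniformConj_of_elem S hc (hf.inv hc),
      uniformDiff_of_elem S hc hf⟩
  | one =>
    refine ⟨fun m hm => ⟨m, hm, ?_⟩, fun m hm => ⟨m, hm, ?_⟩, fun m hm => ⟨m, hm, ?_⟩⟩
    · simp
    · simp
    · simp
  | mul g h _ _ ihg ihh =>
    refine ⟨ihg.1.mul S ihh.1, ?_, ihg.2.2.mul S ihg.1 ihh.2.2⟩
    rw [_root_.mul_inv_rev]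
    exact ihh.2.1.mul S ihg.2.1
  | inv g _ ih =>
    refine ⟨ih.2.1, ?_, ih.2.2.inv S ih.2.1⟩
    rw [inv_inv]
    exact ih.1

variable (C) in
-- The kernel of `A → C` is finitely generated, so a single `s ∈ S` kills it; hence `A → C` is
-- injective on `sA`.
theorem exists_forall_mul_eq_zero [IsNoetherianRing A] :
    ∃ s ∈ S, ∀ a, algebraMap A C (s * a) = 0 → s * a = 0 := by
  obtain ⟨T, hT⟩ := (IsNoetherian.noetherian (RingHom.ker (algebraMap A C)) : Submodule.FG _)
  have h1 : ∀ T : Finset A, (∀ a ∈ T, algebraMap A C a = 0) → ∃ s ∈ S, ∀ a ∈ T, s * a = 0 := by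
    classical
    intro T
    induction T using Finset.induction_on with
    | empty => exact fun _ => ⟨1, S.one_mem, by simp⟩
    | insert a T _ ih =>
      intro h
      obtain ⟨s, hs, hsT⟩ := ih fun b hb => h b (Finset.mem_insert_of_mem hb)
      obtain ⟨t, ht⟩ := (IsLocalization.map_eq_zero_iff S C a).mp (h a (Finset.mem_insert_self _ _))
      refine ⟨s * t, S.mul_mem hs t.2, fun b hb => ?_⟩
      rcases Finset.mem_insert.mp hb with rfl | hb
      · rw [mul_assoc, ht, mul_zero]
      · rw [mul_right_comm, hsT b hb, zero_mul]
  obtain ⟨s, hs, hsT⟩ := h1 T fun a ha => by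
    have : a ∈ RingHom.ker (algebraMap A C) := hT ▸ Submodule.subset_span ha
    exact this
  have h2 : RingHom.ker (algebraMap A C) ≤ LinearMap.ker (LinearMap.mulLeft A s) := by
    rw [← hT]
    exact Submodule.span_le.mpr fun a ha => hsT a ha
  refine ⟨s, hs, fun a ha => ?_⟩
  refine h2 (?_ : algebraMap A C a = 0)
  rw [map_mul] at ha
  exact (IsLocalization.map_units C (⟨s, hs⟩ : S)).mul_right_eq_zero.mp ha

variable (C) in
-- Over `C` the quotient `θ` is a product of elementary matrices with parameters from `mA`; lifting
-- these gives `η ∈ E(n, A)`. Both `η` and `θ` are trivial modulo `m`, so their entries differ by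
-- elements of `mA` that vanish in `C`, and injectivity there forces `η = θ`.
theorem exists_forall_map_mul_inv_mem_E [IsNoetherianRing A] (hc : c.Admissible n)
    (δ : GL (Fin n) A[X])
    (h : GeneralLinearGroup.map (Polynomial.mapRingHom (algebraMap A C)) δ ∈ E n C[X] c) :
    ∃ s ∈ S, ∀ y x : A, GeneralLinearGroup.map (Polynomial.evalRingHom (y + s * x)) δ *
      (GeneralLinearGroup.map (Polynomial.evalRingHom y) δ)⁻¹ ∈ E n A c := by
  obtain ⟨m, hm, hzero⟩ := exists_forall_mul_eq_zero S C
  obtain ⟨k, hk, hdiff⟩ := (uniform_of_mem S hc h).2.2 m hm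
  refine ⟨k * m, S.mul_mem hk hm, fun y x => ?_⟩
  set θ := GeneralLinearGroup.map (Polynomial.evalRingHom (y + k * m * x)) δ *
      (GeneralLinearGroup.map (Polynomial.evalRingHom y) δ)⁻¹ with hθ
  have hev : ∀ y : A, GeneralLinearGroup.map (evalAt C y)
      (GeneralLinearGroup.map (Polynomial.mapRingHom (algebraMap A C)) δ) =
      GeneralLinearGroup.map (algebraMap A C)
        (GeneralLinearGroup.map (Polynomial.evalRingHom y) δ) := by
    intro y
    refine map_map_eq ?_ _
    apply Polynomial.ringHom_ext <;> simp [evalAt]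
  -- The extra factor `m` in the increment is what makes `θ` trivial modulo `m`.
  have h₁ := hdiff y (m * x)
  rw [hev, hev, ← map_inv, ← map_mul, ← mul_assoc, ← hθ] at h₁
  have hset : (level C m : Set C) = algebraMap A C '' {a | m ∣ a} := by
    ext z
    constructor
    · rintro ⟨a, rfl⟩; exact ⟨_, ⟨a, rfl⟩, rfl⟩
    · rintro ⟨_, ⟨a, rfl⟩, rfl⟩; exact ⟨a, rfl⟩
  rw [hset] at h₁
  obtain ⟨η, hη, hηθ⟩ := exists_map_eq_of_mem_elemGroup hc _ h₁
  let π := Ideal.Quotient.mk (Ideal.span {m})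
  have hπη : GeneralLinearGroup.map π η = 1 := by
    refine map_eq_one_of_mem_elemGroup π ?_ hη
    rintro z hz
    exact Ideal.Quotient.eq_zero_iff_mem.mpr (Ideal.mem_span_singleton.mpr hz)
  have hπθ : GeneralLinearGroup.map π θ = 1 := by
    rw [hθ, map_mul, map_inv, mul_inv_eq_one]
    refine map_map_eq ?_ _
    have : π m = 0 := Ideal.Quotient.eq_zero_iff_mem.mpr (Ideal.mem_span_singleton_self m)
    apply Polynomial.ringHom_ext <;> simp [this]
  have e : η = θ := by
    ext i j
    have h₂ : π (η i j) = π (θ i j) := by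
      rw [← GeneralLinearGroup.map_apply, ← GeneralLinearGroup.map_apply, hπη, hπθ]
    have h₃ : algebraMap A C (η i j) = algebraMap A C (θ i j) := by
      rw [← GeneralLinearGroup.map_apply, ← GeneralLinearGroup.map_apply, hηθ]
    obtain ⟨a, ha⟩ := Ideal.mem_span_singleton.mp (Ideal.Quotient.eq.mp h₂)
    rw [← sub_eq_zero, ha]
    apply hzero
    rw [← ha, map_sub, h₃, sub_self]
  rw [← e, E_eq_elemGroup hc]
  exact Subgroup.closure_mono (by rintro x ⟨z, -, hx⟩; exact ⟨z, trivial, hx⟩) hη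

end Dilation

/-! ### The Quillen ideal. -/

section Quillen

variable {n : ℕ} {c : Kind} {A : Type*} [CommRing A]

/-- The ideal of all `a` such that specializations of `δ` at elements congruent modulo `a` agree
modulo the elementary group. -/
def quillenIdeal (c : Kind) (δ : GL (Fin n) A[X]) : Ideal A where
  carrier := {a | ∀ y x : A, GeneralLinearGroup.map (Polynomial.evalRingHom (y + a * x)) δ *
      (GeneralLinearGroup.map (Polynomial.evalRingHom y) δ)⁻¹ ∈ E n A c}
  add_mem' := by
    intro a b ha hb y x
    have := mul_mem (ha (y + b * x) x) (hb y x)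
    rw [← mul_assoc, inv_mul_cancel_right, show y + b * x + a * x = y + (a + b) * x by ring] at this
    exact this
  zero_mem' := by intro y x; simp
  smul_mem' := by
    intro b a ha y x
    have := ha y (b * x)
    rwa [← mul_assoc, mul_comm a] at this

theorem map_one_mul_map_zero_inv_mem_E {δ : GL (Fin n) A[X]} (h : quillenIdeal c δ = ⊤) :
    GeneralLinearGroup.map (Polynomial.evalRingHom 1) δ *
      (GeneralLinearGroup.map (Polynomial.evalRingHom 0) δ)⁻¹ ∈ E n A c := by
  have h1 : (1 : A) ∈ quillenIdeal c δ := h ▸ Submodule.mem_top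
  have := h1 0 1
  rwa [mul_one, zero_add] at this

end Quillen

/-! ### Transformations along a vector with an invertible coordinate. -/

section UnitCoordinate

variable {n : ℕ} {c : Kind} {R : Type*} [CommRing R]

theorem eq_sum_bv (w : Fin n → R) {p : Fin n} (hp : w p = 0) :
    w = ∑ k ∈ Finset.univ.erase p, w k • bv R k := by
  ext j
  simp only [bv, Finset.sum_apply, Pi.smul_apply, Pi.single_apply, smul_eq_mul, mul_ite, mul_one,
    mul_zero, Finset.sum_ite_eq, Finset.mem_erase, Finset.mem_univ, and_true]
  split_ifs with h
  · rfl
  · rw [not_not.mp h, hp]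

theorem inn_bv_eq_zero_iff (hn : Even n) (p : Fin n) (w : Fin n → R) :
    inn c (bv R p) w = 0 ↔ w (partner p) = 0 := by
  rw [bv, inn_single_left hn]
  rcases rowSign_eq (R := R) c p with h | h <;> rw [h] <;> simp

theorem inn_bv_self (hn : Even n) (c : Kind) (p : Fin n) : inn c (bv R p) (bv R p) = 0 := by
  rw [inn_single_single hn, if_neg (partner_ne hn p).symm]

/-- The vector is assembled one coordinate at a time by the Heisenberg law. The cocycle determines
`Q`, and the isometry relation persists at each step. -/
theorem exists_memElem_siegel_bv (hc : c.Admissible n) (hl : c ≠ .linear) {p : Fin n}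
    {w : Fin n → R} (hw : w (partner p) = 0) :
    ∃ Q, (1 + lam R c) * Q + inn c w w = 0 ∧ MemElem c Set.univ (siegel c (bv R p) w Q) := by
  have hn := hc.even hl
  have key : ∀ s : Finset (Fin n), partner p ∉ s → ∃ Q,
      (1 + lam R c) * Q + inn c (∑ k ∈ s, w k • bv R k) (∑ k ∈ s, w k • bv R k) = 0 ∧
      inn c (bv R p) (∑ k ∈ s, w k • bv R k) = 0 ∧
      MemElem c Set.univ (siegel c (bv R p) (∑ k ∈ s, w k • bv R k) Q) := by
    intro s
    induction s using Finset.induction_on with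
    | empty =>
      intro _
      refine ⟨0, ?_, ?_, ?_⟩
      · simp [inn_zero_left]
      · simp [inn_zero_right]
      · rw [Finset.sum_empty, siegel_zero]; exact MemElem.one _ _
    | insert k s hk ih =>
      intro hs
      rw [Finset.mem_insert, not_or] at hs
      obtain ⟨Q, h₁, h₂, h₃⟩ := ih hs.2
      have hk' : inn c (bv R p) (w k • bv R k) = 0 := by
        rw [inn_smul_right, inn_single_single hn, if_neg (Ne.symm hs.1), mul_zero]
      have hkk : inn c (w k • bv R k) (w k • bv R k) = 0 := by
        rw [inn_smul_right, inn_smul_left, inn_bv_self hn, mul_zero, mul_zero]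
      have hm := (memElem_siegel_single (W := ⊤) hc hl (Ne.symm hs.1)
        (NonUnitalSubring.mem_top (w k))).mul h₃
      rw [siegel_mul_siegel hn _ _ _ (inn_bv_self hn c p) hk' h₂,
        ← Finset.sum_insert (f := fun k => w k • bv R k) hk] at hm
      refine ⟨_, ?_, ?_, hm⟩
      · rw [Finset.sum_insert hk]
        generalize (∑ k ∈ s, w k • bv R k) = y at *
        simp only [inn_add_left, inn_add_right, hkk]
        rw [inn_symm hn c (w k • bv R k) y]
        linear_combination h₁ - inn c (w k • bv R k) y * lam_mul_lam (R := R) c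
      · rw [Finset.sum_insert hk, inn_add_right, hk', h₂, add_zero]
  obtain ⟨Q, h₁, -, h₃⟩ := key (Finset.univ.erase (partner p)) (Finset.notMem_erase _ _)
  rw [← eq_sum_bv w hw] at h₁ h₃
  exact ⟨Q, h₁, h₃⟩

/-- In the orthogonal case, `2` is a non-zero-divisor in `R`. -/
def TwoRegular (c : Kind) (R : Type*) [CommRing R] : Prop :=
  c = .orthogonal → ∀ x : R, 2 * x = 0 → x = 0

/-- The scalar may differ from the assembled one. In the symplectic case a long generator corrects
it; in the orthogonal case `2Q = -⟨w, w⟩` determines it, since `2` is regular. -/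
theorem memElem_siegel_bv (hc : c.Admissible n) (hl : c ≠ .linear) (h2 : TwoRegular c R)
    {p : Fin n} {w : Fin n → R} (hw : inn c (bv R p) w = 0) {Q : R}
    (hQ : (1 + lam R c) * Q + inn c w w = 0) :
    MemElem c Set.univ (siegel c (bv R p) w Q) := by
  have hn := hc.even hl
  obtain ⟨Q', hQ', h⟩ := exists_memElem_siegel_bv hc hl ((inn_bv_eq_zero_iff hn p w).mp hw)
  cases c with
  | linear => exact absurd rfl hl
  | symplectic =>
    have := h.mul ((Elem.long rfl p (Q - Q')).memElem hc (Set.mem_univ _))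
    rw [siegel_mul_siegel hn _ _ _ (inn_bv_self hn _ p) hw (inn_zero_right _ _), inn_zero_right,
      mul_zero, sub_zero, add_zero, add_sub_cancel] at this
    exact this
  | orthogonal =>
    have : Q = Q' := sub_eq_zero.mp (h2 rfl _ (by simp only [lam] at hQ hQ'; linear_combination hQ - hQ'))
    rwa [this]

/-- A transformation based at `e_{σ(p)}` sends `e_p` to `e_p` plus a multiple of `w` and a multiple
of `e_{σ(p)}`. So `w` is the rest of `v`, and `Q` its `σ(p)`-coordinate, rescaled by the inverse `b`
of `v p` and signs. -/
theorem exists_siegel_mulVec_eq (hn : Even n) {v : Fin n → R} (hv : inn c v v = 0)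
    {p : Fin n} {b : R} (hb : v p * b = 1) :
    ∃ w Q, inn c (bv R (partner p)) w = 0 ∧ (1 + lam R c) * Q + inn c w w = 0 ∧
      siegel c (bv R (partner p)) w Q *ᵥ (v p • bv R p) = v := by
  set η : R := rowSign R c (partner p) with hη
  have hηη : η * η = 1 := rowSign_mul_self _ _
  set v' : Fin n → R := v - v p • bv R p - v (partner p) • bv R (partner p) with hv'
  have hpp := partner_ne hn p
  have h₁ : v' p = 0 := by simp [hv', bv, hpp.symm]
  have h₂ : v' (partner p) = 0 := by simp [hv', bv, hpp]
  have hw : inn c (bv R (partner p)) (-(lam R c * η * b) • v') = 0 := by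
    rw [inn_bv_eq_zero_iff hn, partner_partner hn]
    simp [h₁]
  have hw' : inn c v' (bv R p) = 0 := by
    rw [inn_symm hn c (bv R p), (inn_bv_eq_zero_iff hn _ _).mpr h₂, mul_zero]
  have hpη : inn c (bv R (partner p)) (bv R p) = η := by
    rw [inn_single_single hn, partner_partner hn, if_pos rfl]
  have e : siegel c (bv R (partner p)) (-(lam R c * η * b) • v') (η * b * v (partner p)) *ᵥ
      (v p • bv R p) = v := by
    rw [mulVec_smul, siegel_mulVec, inn_smul_left, hw', hpη]
    have e1 : v p * (η * b * v (partner p) * η) = v (partner p) := by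
      linear_combination v (partner p) * η * η * hb + v (partner p) * hηη
    have e2 : v p * (lam R c * η) * (-(lam R c * η * b)) = -1 := by
      linear_combination (-(lam R c * lam R c * η * η)) * hb - η * η * lam_mul_lam (R := R) c - hηη
    rw [mul_zero, zero_add, smul_sub, smul_add, smul_smul, smul_smul, smul_smul, e1, e2, hv']
    module
  refine ⟨_, _, hw, ?_, e⟩
  -- Isotropy of `v` makes the isometry defect, multiplied twice by the unit `v p`, vanish; this
  -- yields the relation for `Q`.
  have h := hv
  rw [← e, mulVec_smul, inn_smul_left, inn_smul_right,
    inn_siegel hn c (inn_bv_self hn c _) hw, inn_bv_self hn, zero_add, hpη, hηη, one_mul] at h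
  have hu : IsUnit (v p) := IsUnit.of_mul_eq_one _ hb
  exact hu.mul_right_eq_zero.mp (hu.mul_right_eq_zero.mp h)

/-- An elementary isometry carries `v p • e_p` to `v`. Conjugating back and moving the scalar from
the first vector into the second reduces to a transformation based at `e_p`. -/
theorem memElem_siegel_of_unit (hc : c.Admissible n) (hl : c ≠ .linear) (h2 : TwoRegular c R)
    {v w : Fin n → R} (hv : inn c v v = 0) (hvw : inn c v w = 0) {Q : R}
    (hQ : (1 + lam R c) * Q + inn c w w = 0) {p : Fin n} (hp : IsUnit (v p)) :
    MemElem c Set.univ (siegel c v w Q) := by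
  have hn := hc.even hl
  obtain ⟨b, hb⟩ := hp.exists_right_inv
  obtain ⟨w₁, Q₁, h₁, h₃, h₄⟩ := exists_siegel_mulVec_eq hn hv hb
  obtain ⟨g, hg, hgv⟩ := memElem_siegel_bv hc hl h2 h₁ h₃
  have hgP : PreservesInn c (g : Matrix (Fin n) (Fin n) R) := by
    rw [hgv]; exact preservesInn_siegel hn c (inn_bv_self hn c _) h₁ h₃
  rw [← hgv] at h₄
  set w' := ((g⁻¹ : GL (Fin n) R) : Matrix (Fin n) (Fin n) R) *ᵥ w with hw'
  have hgw : (g : Matrix (Fin n) (Fin n) R) *ᵥ w' = w := by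
    rw [hw', mulVec_mulVec, ← Units.val_mul, mul_inv_cancel, Units.val_one, one_mulVec]
  have hm : MemElem c Set.univ (siegel c (bv R p) (v p • w') (v p * v p * Q)) := by
    apply memElem_siegel_bv hc hl h2
    · rw [inn_smul_right, ← inn_smul_left, ← hgP, h₄, hgw, hvw]
    · rw [inn_smul_left, inn_smul_right, ← hgP, hgw]
      linear_combination v p * v p * hQ
  rw [← siegel_smul_left] at hm
  have := siegel_conj_gl hgP (v p • bv R p) w' Q
  rw [h₄, hgw] at this
  rw [← this]
  exact (MemElem.mul ⟨g, hg, rfl⟩ hm).mul ⟨g⁻¹, inv_mem hg, rfl⟩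

theorem memElem_one_add_bv_vecMulVec (hc : Kind.linear.Admissible n) {p : Fin n} {w : Fin n → R}
    (hw : w p = 0) : MemElem .linear Set.univ (1 + vecMulVec (bv R p) w) := by
  have key : ∀ s : Finset (Fin n), p ∉ s →
      MemElem .linear Set.univ (1 + vecMulVec (bv R p) (∑ k ∈ s, w k • bv R k)) := by
    intro s
    induction s using Finset.induction_on with
    | empty => intro _; simpa using MemElem.one (R := R) (n := n) .linear Set.univ
    | insert k s hk ih =>
      intro hs
      rw [Finset.mem_insert, not_or] at hs
      have := ((Elem.lin rfl p k hs.1 (w k)).memElem hc (Set.mem_univ _)).mul (ih hs.2)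
      rw [Finset.sum_insert hk, vecMulVec_add, vecMulVec_smul, vecMulVec_bv, smul_single,
        smul_eq_mul, mul_one]
      have e : Matrix.single p k (w k) * vecMulVec (bv R p) (∑ k ∈ s, w k • bv R k) = 0 := by
        rw [mul_vecMulVec, show Matrix.single p k (w k) *ᵥ bv R p = 0 by
          ext j; simp [bv, Ne.symm hs.1], zero_vecMulVec]
      rw [add_mul, one_mul, mul_add, mul_one, e, add_zero] at this
      convert this using 1
      abel
  rw [eq_sum_bv w hw]
  exact key _ (Finset.notMem_erase _ _)

theorem memElem_one_add_vecMulVec_bv (hc : Kind.linear.Admissible n) {p : Fin n} {w : Fin n → R}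
    (hw : w p = 0) : MemElem .linear Set.univ (1 + vecMulVec w (bv R p)) := by
  have key : ∀ s : Finset (Fin n), p ∉ s →
      MemElem .linear Set.univ (1 + vecMulVec (∑ k ∈ s, w k • bv R k) (bv R p)) := by
    intro s
    induction s using Finset.induction_on with
    | empty => intro _; simpa using MemElem.one (R := R) (n := n) .linear Set.univ
    | insert k s hk ih =>
      intro hs
      rw [Finset.mem_insert, not_or] at hs
      have := (ih hs.2).mul ((Elem.lin rfl k p (Ne.symm hs.1) (w k)).memElem hc (Set.mem_univ _))
      rw [Finset.sum_insert hk, add_vecMulVec, smul_vecMulVec, vecMulVec_bv, smul_single,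
        smul_eq_mul, mul_one]
      have e : vecMulVec (∑ k ∈ s, w k • bv R k) (bv R p) * Matrix.single k p (w k) = 0 := by
        rw [vecMulVec_mul, show bv R p ᵥ* Matrix.single k p (w k) = 0 by
          ext j; simp [bv, Ne.symm hs.1], vecMulVec_zero]
      rw [add_mul, one_mul, mul_add, mul_one, e, add_zero] at this
      convert this using 1
      abel
  rw [eq_sum_bv w hw]
  exact key _ (Finset.notMem_erase _ _)

/-- The linear analogue: `g` adds multiples of the invertible coordinate to the others, carrying `v
p • e_p` to `v`, and conjugation reduces to a single nontrivial row. -/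
theorem memElem_one_add_vecMulVec_of_unit (hc : Kind.linear.Admissible n) {v w : Fin n → R}
    (hvw : v ⬝ᵥ w = 0) {p : Fin n} (hp : IsUnit (v p)) :
    MemElem .linear Set.univ (1 + vecMulVec v w) := by
  obtain ⟨b, hb⟩ := hp.exists_right_inv
  obtain ⟨g, hg, hgv⟩ := memElem_one_add_vecMulVec_bv hc (p := p) (w := b • v - bv R p)
    (by simp [bv, mul_comm b, hb])
  have hge : (g : Matrix (Fin n) (Fin n) R) *ᵥ (v p • bv R p) = v := by
    have e : bv R p ⬝ᵥ bv R p = 1 := by simp [bv]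
    rw [hgv, mulVec_smul, add_mulVec, one_mulVec, vecMulVec_mulVec, e]
    simp [smul_smul, hb]
  have hm := memElem_one_add_bv_vecMulVec hc (p := p) (w := v p • (w ᵥ* (g : Matrix (Fin n) (Fin n) R)))
    (by
      have : (w ᵥ* (g : Matrix (Fin n) (Fin n) R)) ⬝ᵥ (v p • bv R p) = 0 := by
        rw [← dotProduct_mulVec, hge, dotProduct_comm, hvw]
      simpa [bv] using this)
  have e : (1 : Matrix (Fin n) (Fin n) R) + vecMulVec v w =
      g * (1 + vecMulVec (bv R p) (v p • (w ᵥ* (g : Matrix (Fin n) (Fin n) R)))) *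
        ((g⁻¹ : GL (Fin n) R) : Matrix (Fin n) (Fin n) R) := by
    have hgi : (g : Matrix (Fin n) (Fin n) R) * ((g⁻¹ : GL (Fin n) R) : Matrix (Fin n) (Fin n) R) = 1 := by
      rw [← Units.val_mul, mul_inv_cancel, Units.val_one]
    rw [vecMulVec_smul, ← smul_vecMulVec, mul_add, mul_one, add_mul, mul_vecMulVec, hge,
      vecMulVec_mul, vecMul_vecMul, hgi, vecMul_one]
  rw [e]
  exact (MemElem.mul ⟨g, hg, rfl⟩ hm).mul ⟨g⁻¹, inv_mem hg, rfl⟩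

end UnitCoordinate

/-! ### Unimodular vectors and normality. -/

section Unimodular

variable {n : ℕ} {c : Kind} {A : Type*} [CommRing A]

theorem TwoRegular.localization (h : TwoRegular c A) (S : Submonoid A) (C : Type*) [CommRing C]
    [Algebra A C] [IsLocalization S C] : TwoRegular c C := by
  intro hc x hx
  obtain ⟨a, s, rfl⟩ := IsLocalization.exists_mk'_eq S x
  have h1 : algebraMap A C (2 * a) = 0 := by
    rw [map_mul, map_ofNat, ← IsLocalization.mk'_spec C a s, ← mul_assoc, hx, zero_mul]
  obtain ⟨t, ht⟩ := (IsLocalization.map_eq_zero_iff S C _).mp h1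
  rw [IsLocalization.mk'_eq_zero_iff]
  exact ⟨t, h hc _ (by rw [← ht]; ring)⟩

theorem TwoRegular.polynomial (h : TwoRegular c A) : TwoRegular c A[X] := by
  intro hc f hf
  ext i
  have := congrArg (fun g => Polynomial.coeff g i) hf
  rw [Polynomial.coeff_zero]
  refine h hc _ ?_
  simpa [two_mul] using this

/-- Descent from each `A_{v p}` puts a power of `v p` into the Quillen ideal. Its radical then
contains all coordinates of a unimodular vector, hence `1`. -/
theorem map_one_mul_map_zero_inv_mem_E_of_unimodular [IsNoetherianRing A] (hc : c.Admissible n)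
    {δ : GL (Fin n) A[X]} {v : Fin n → A} (hv : IsUnimodular v)
    (h : ∀ p, GeneralLinearGroup.map
      (Polynomial.mapRingHom (algebraMap A (Localization.Away (v p)))) δ ∈
        E n (Localization.Away (v p))[X] c) :
    GeneralLinearGroup.map (Polynomial.evalRingHom 1) δ *
      (GeneralLinearGroup.map (Polynomial.evalRingHom 0) δ)⁻¹ ∈ E n A c := by
  apply map_one_mul_map_zero_inv_mem_E
  have h1 : ∀ p, v p ∈ (quillenIdeal c δ).radical := by
    intro p
    obtain ⟨_, ⟨k, rfl⟩, hs⟩ := exists_forall_map_mul_inv_mem_E (Submonoid.powers (v p))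
      (Localization.Away (v p)) hc δ (h p)
    exact ⟨k, hs⟩
  obtain ⟨b, hb⟩ := hv
  rw [← Ideal.radical_eq_top, Ideal.eq_top_iff_one, ← hb]
  exact Ideal.sum_mem _ fun i _ => Ideal.mul_mem_right _ _ (h1 i)

theorem inn_map {R : Type*} [CommRing R] (φ : A →+* R) (c : Kind) (x y : Fin n → A) :
    inn c (φ ∘ x) (φ ∘ y) = φ (inn c x y) := by
  rw [inn, inn, ← gram_map φ, RingHom.map_dotProduct]
  congr 1
  ext j
  exact (RingHom.map_vecMul φ _ _ _).symm

/-- The homotopy replaces `w` by `X w` and `Q` by `X² Q`, which preserves the isometry relation. It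
joins the identity at `X = 0` to the given matrix at `X = 1`, and is elementary wherever a
coordinate of `v` is invertible. -/
theorem memE_siegel_of_unimodular [IsNoetherianRing A] (hc : c.Admissible n) (hl : c ≠ .linear)
    (h2 : TwoRegular c A) {v w : Fin n → A} (hv : IsUnimodular v) (hvv : inn c v v = 0)
    (hvw : inn c v w = 0) {Q : A} (hQ : (1 + lam A c) * Q + inn c w w = 0) :
    MemE c (siegel c v w Q) := by
  have hn := hc.even hl
  set w' : Fin n → A[X] := (Polynomial.X : A[X]) • (Polynomial.C ∘ w) with hw'
  set Q' : A[X] := Polynomial.X * Polynomial.X * Polynomial.C Q with hQ'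
  have e₁ : inn c (Polynomial.C ∘ v) (Polynomial.C ∘ v) = 0 := by rw [inn_map, hvv, map_zero]
  have e₂ : inn c (Polynomial.C ∘ v) w' = 0 := by
    rw [hw', inn_smul_right, inn_map, hvw, map_zero, mul_zero]
  have e₃ : (1 + lam A[X] c) * Q' + inn c w' w' = 0 := by
    rw [hw', inn_smul_right, inn_smul_left, inn_map, ← map_lam Polynomial.C]
    have := congrArg Polynomial.C hQ
    simp only [map_add, map_mul, map_one, map_zero] at this
    linear_combination Polynomial.X * Polynomial.X * this
  obtain ⟨δ, hδ⟩ : ∃ δ : GL (Fin n) A[X],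
      (δ : Matrix (Fin n) (Fin n) A[X]) = siegel c (Polynomial.C ∘ v) w' Q' := by
    have := siegel_mul_siegel_neg hn c Q' e₁ e₂ e₃
    exact ⟨⟨_, _, this, mul_eq_one_comm.mp this⟩, rfl⟩
  have hval : ∀ {R : Type _} [CommRing R] (φ : A[X] →+* R),
      (GeneralLinearGroup.map φ δ : Matrix (Fin n) (Fin n) R) =
        siegel c (φ ∘ Polynomial.C ∘ v) (φ ∘ w') (φ Q') := by
    intro R _ φ
    rw [← siegel_map, ← hδ]
    rfl
  have hmain := map_one_mul_map_zero_inv_mem_E_of_unimodular (δ := δ) hc hv (by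
    intro p
    rw [E_eq_elemGroup hc]
    apply MemElem.mem
    rw [hval]
    refine memElem_siegel_of_unit hc hl
      (h2.localization (Submonoid.powers (v p)) (Localization.Away (v p))).polynomial
      ?_ ?_ ?_ (p := p) ?_
    · rw [inn_map, e₁, map_zero]
    · rw [inn_map, e₂, map_zero]
    · rw [inn_map, ← map_lam (Polynomial.mapRingHom (algebraMap A (Localization.Away (v p)))),
        ← map_one (Polynomial.mapRingHom (algebraMap A (Localization.Away (v p)))), ← map_add,
        ← map_mul, ← map_add, e₃, map_zero]
    · have := (IsLocalization.Away.algebraMap_isUnit (S := Localization.Away (v p)) (v p)).map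
        (Polynomial.C (R := Localization.Away (v p)))
      simpa using this)
  refine ⟨_, hmain, ?_⟩
  have h0 : GeneralLinearGroup.map (Polynomial.evalRingHom 0) δ = 1 := by
    apply Units.ext
    rw [hval, show Polynomial.evalRingHom 0 ∘ w' = 0 by ext; simp [hw'],
      show Polynomial.evalRingHom 0 Q' = 0 by simp [hQ'], siegel_zero]
    rfl
  have h1 : (GeneralLinearGroup.map (Polynomial.evalRingHom 1) δ : Matrix (Fin n) (Fin n) A) =
      siegel c v w Q := by
    rw [hval]
    congr 1
    · ext; simp
    · ext; simp [hw']
    · simp [hQ']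
  rw [h0, inv_one, mul_one, h1]

theorem one_add_vecMulVec_mul_neg {R : Type*} [CommRing R] {v w : Fin n → R} (h : v ⬝ᵥ w = 0) :
    (1 + vecMulVec v w) * (1 + vecMulVec v (-w)) = 1 := by
  have h' : w ⬝ᵥ v = 0 := by rw [dotProduct_comm, h]
  rw [mul_add, mul_one, add_mul, one_mul, vecMulVec_mul_vecMulVec, h', zero_smul, vecMulVec_zero,
    add_zero, vecMulVec_neg]
  abel

theorem memE_one_add_vecMulVec_of_unimodular [IsNoetherianRing A] (hc : Kind.linear.Admissible n)
    {v w : Fin n → A} (hv : IsUnimodular v) (hvw : v ⬝ᵥ w = 0) :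
    MemE .linear (1 + vecMulVec v w) := by
  set w' : Fin n → A[X] := (Polynomial.X : A[X]) • (Polynomial.C ∘ w) with hw'
  have e : (Polynomial.C ∘ v) ⬝ᵥ w' = 0 := by
    rw [hw', dotProduct_smul, ← RingHom.map_dotProduct, hvw, map_zero, smul_zero]
  obtain ⟨δ, hδ⟩ : ∃ δ : GL (Fin n) A[X],
      (δ : Matrix (Fin n) (Fin n) A[X]) = 1 + vecMulVec (Polynomial.C ∘ v) w' := by
    have := one_add_vecMulVec_mul_neg e
    exact ⟨⟨_, _, this, mul_eq_one_comm.mp this⟩, rfl⟩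
  have hval : ∀ {R : Type _} [CommRing R] (φ : A[X] →+* R),
      (GeneralLinearGroup.map φ δ : Matrix (Fin n) (Fin n) R) =
        1 + vecMulVec (φ ∘ Polynomial.C ∘ v) (φ ∘ w') := by
    intro R _ φ
    ext i j
    rw [GeneralLinearGroup.map_apply, hδ]
    simp [vecMulVec_apply, Matrix.one_apply, apply_ite φ]
  have hmain := map_one_mul_map_zero_inv_mem_E_of_unimodular (δ := δ) hc hv (by
    intro p
    rw [E_eq_elemGroup hc]
    apply MemElem.mem
    rw [hval]
    refine memElem_one_add_vecMulVec_of_unit hc ?_ (p := p) ?_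
    · rw [← RingHom.map_dotProduct, e, map_zero]
    · have := (IsLocalization.Away.algebraMap_isUnit (S := Localization.Away (v p)) (v p)).map
        (Polynomial.C (R := Localization.Away (v p)))
      simpa using this)
  refine ⟨_, hmain, ?_⟩
  have h0 : GeneralLinearGroup.map (Polynomial.evalRingHom 0) δ = 1 := by
    apply Units.ext
    rw [hval, show Polynomial.evalRingHom 0 ∘ w' = 0 by ext; simp [hw'], vecMulVec_zero, add_zero]
    rfl
  have h1 : (GeneralLinearGroup.map (Polynomial.evalRingHom 1) δ : Matrix (Fin n) (Fin n) A) =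
      1 + vecMulVec v w := by
    rw [hval]
    congr 2
    · ext; simp
    · ext; simp [hw']
  rw [h0, inv_one, mul_one, h1]

theorem memE_one_add_transMatrix [IsNoetherianRing A] (hc : c.Admissible n) (h2 : TwoRegular c A)
    {v w : Fin n → A} (hv : IsUnimodular v) (h : TransPair c v w) :
    MemE c (1 + transMatrix c v w) := by
  cases c with
  | linear => exact memE_one_add_vecMulVec_of_unimodular hc hv h
  | symplectic =>
    have := memE_siegel_of_unimodular hc (by simp) h2 hv (inn_self_symplectic hc.1 v) h (Q := 0)
      (by rw [mul_zero, zero_add, inn_self_symplectic hc.1])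
    have e : siegel .symplectic v w 0 = 1 + transMatrix .symplectic v w := by
      simp only [siegel, transMatrix, lam, neg_smul, one_smul, zero_smul, add_zero, sub_neg_eq_add,
        add_assoc]
      rfl
    rwa [e] at this
  | orthogonal =>
    have := memE_siegel_of_unimodular hc (by simp) h2 hv h.2.1 h.1 (Q := 0)
      (by rw [mul_zero, zero_add]; exact h.2.2)
    have e : siegel .orthogonal v w 0 = 1 + transMatrix .orthogonal v w := by
      simp only [siegel, transMatrix, lam, one_smul, zero_smul, add_zero, add_sub_assoc]
      rfl
    rwa [e] at this

theorem preservesInn_of_mem_isometryGroup {g : GL (Fin n) A} (hg : g ∈ isometryGroup (gram n A c)) :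
    PreservesInn c (g : Matrix (Fin n) (Fin n) A) := by
  intro x y
  have h : (g : Matrix (Fin n) (Fin n) A)ᵀ * gram n A c * (g : Matrix (Fin n) (Fin n) A) =
    gram n A c := hg
  rw [inn, inn, ← vecMul_transpose, vecMul_vecMul, dotProduct_mulVec, vecMul_vecMul, h]

theorem preservesInn_of_mem_G (hl : c ≠ .linear) {g : GL (Fin n) A} (hg : g ∈ G n A c) :
    PreservesInn c (g : Matrix (Fin n) (Fin n) A) := by
  cases c with
  | linear => exact absurd rfl hl
  | symplectic => exact preservesInn_of_mem_isometryGroup hg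
  | orthogonal => exact preservesInn_of_mem_isometryGroup hg

theorem isUnimodular_mulVec_bv (g : GL (Fin n) A) (p : Fin n) :
    IsUnimodular ((g : Matrix (Fin n) (Fin n) A) *ᵥ bv A p) := by
  refine ⟨bv A p ᵥ* ((g⁻¹ : GL (Fin n) A) : Matrix (Fin n) (Fin n) A), ?_⟩
  rw [dotProduct_comm, dotProduct_mulVec, vecMul_vecMul, ← Units.val_mul, inv_mul_cancel,
    Units.val_one, vecMul_one]
  simp [bv]

/-- Conjugating a generator by `g` replaces its base vector `e_p` by `g e_p`, a column of an
invertible matrix and hence unimodular. Long symplectic generators are the reason for allowing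
nonzero `Q`. -/
theorem conj_mem_E [IsNoetherianRing A] (hc : c.Admissible n) (h2 : TwoRegular c A)
    {g x : GL (Fin n) A} (hg : g ∈ G n A c) (hx : x ∈ E n A c) : g * x * g⁻¹ ∈ E n A c := by
  have key : ∀ z (P : Matrix (Fin n) (Fin n) A), Elem c z P →
      MemE c ((g : Matrix (Fin n) (Fin n) A) * P * ((g⁻¹ : GL (Fin n) A) : Matrix _ _ A)) := by
    intro z P hP
    cases hP with
    | lin h i j hij =>
      subst h
      have e : (g : Matrix (Fin n) (Fin n) A) * (1 + Matrix.single i j z) *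
          ((g⁻¹ : GL (Fin n) A) : Matrix _ _ A) =
          1 + vecMulVec ((g : Matrix (Fin n) (Fin n) A) *ᵥ bv A i)
            (z • (bv A j ᵥ* ((g⁻¹ : GL (Fin n) A) : Matrix (Fin n) (Fin n) A))) := by
        have e1 : Matrix.single i j z = z • vecMulVec (bv A i) (bv A j) := by
          rw [vecMulVec_bv, smul_single, smul_eq_mul, mul_one]
        rw [e1, mul_add, mul_one, add_mul, ← Units.val_mul, mul_inv_cancel, Units.val_one,
          vecMulVec_smul, mul_smul_comm, mul_vecMulVec, smul_mul_assoc, vecMulVec_mul]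
      rw [e]
      apply memE_one_add_vecMulVec_of_unimodular hc (isUnimodular_mulVec_bv g i)
      rw [dotProduct_smul, dotProduct_comm, dotProduct_mulVec, vecMul_vecMul, ← Units.val_mul,
        inv_mul_cancel, Units.val_one, vecMul_one]
      simp [bv, hij]
    | short h p q h₁ h₂ =>
      have hn := hc.even h
      have hgP := preservesInn_of_mem_G h hg
      rw [siegel_conj_gl hgP]
      apply memE_siegel_of_unimodular hc h h2 (isUnimodular_mulVec_bv g p)
      · rw [hgP, inn_bv_self hn]
      · rw [hgP, inn_smul_right, inn_single_single hn, if_neg h₂, mul_zero]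
      · rw [hgP, inn_smul_right, inn_smul_left, inn_bv_self hn]
        ring
    | long h p =>
      subst h
      have hn := hc.1
      have hgP := preservesInn_of_mem_G (by simp) hg
      rw [siegel_conj_gl hgP]
      apply memE_siegel_of_unimodular hc (by simp) h2 (isUnimodular_mulVec_bv g p)
      · rw [hgP, inn_bv_self hn]
      · rw [mulVec_zero, inn_zero_right]
      · rw [mulVec_zero, inn_zero_right]; simp [lam]
  have hle : elemGroup c n Set.univ ≤ (E n A c).comap (MulAut.conj g).toMonoidHom := by
    refine (Subgroup.closure_le _).mpr ?_
    rintro x ⟨z, -, hx⟩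
    obtain ⟨y, hy, hyx⟩ := key z _ hx
    have : y = g * x * g⁻¹ := Units.ext hyx
    rw [this] at hy
    exact hy
  rw [E_eq_elemGroup hc] at hx
  exact hle hx

end Unimodular

/-! ### The graded homotopy as specialization of a polynomial matrix. -/

section Graded

variable {n : ℕ} {c : Kind} {A : Type*} [CommRing A] (𝒜 : ℕ → AddSubgroup A) [GradedRing 𝒜]

theorem epsilon_of_mem {i : ℕ} {a : A} (ha : a ∈ 𝒜 i) :
    epsilon 𝒜 a = Polynomial.monomial i a := by
  lift a to 𝒜 i using ha
  simp only [epsilon, DirectSum.decomposeRingEquiv, RingHom.comp_apply, RingEquiv.toRingHom_eq_coe,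
    RingHom.coe_coe]
  erw [DirectSum.decompose_coe, DirectSum.toSemiring_of]
  rfl

theorem evalRingHom_one_comp_epsilon :
    (Polynomial.evalRingHom (1 : A)).comp (epsilon 𝒜) = RingHom.id A := by
  ext a
  induction a using DirectSum.Decomposition.inductionOn 𝒜 with
  | zero => simp
  | homogeneous m => simp [epsilon_of_mem 𝒜 m.2]
  | add x y hx hy => rw [map_add, hx, hy, map_add]

/-- The matrix over `A[X]` whose specializations are the `α⁺(a)`. -/
noncomputable def epsilonGL (α : GL (Fin n) A) : GL (Fin n) A[X] :=
  GeneralLinearGroup.map (epsilon 𝒜) α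

theorem map_epsilonGL_eq_plus (α : GL (Fin n) A) (a : 𝒜 0) :
    GeneralLinearGroup.map (Polynomial.evalRingHom (a : A)) (epsilonGL 𝒜 α) = plus 𝒜 α a := rfl

theorem map_epsilonGL_one (α : GL (Fin n) A) :
    GeneralLinearGroup.map (Polynomial.evalRingHom (1 : A)) (epsilonGL 𝒜 α) = α := by
  rw [epsilonGL, ← GeneralLinearGroup.map_comp_apply]
  ext i j
  exact DFunLike.congr_fun (evalRingHom_one_comp_epsilon 𝒜) (α i j)

/-- If the image of `α` in a localization at elements of degree `0` is elementary, then so is the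
image of its homotopy. -/
theorem map_epsilonGL_mem_E (hc : c.Admissible n) (S : Submonoid A) (hS : ∀ s ∈ S, s ∈ 𝒜 0)
    (C : Type*) [CommRing C] [Algebra A C] [IsLocalization S C] {α : GL (Fin n) A}
    (h : locGL C α ∈ E n C c) :
    GeneralLinearGroup.map (Polynomial.mapRingHom (algebraMap A C)) (epsilonGL 𝒜 α) ∈
      E n C[X] c := by
  -- Elements of degree `0` go to constant polynomials, so `ε` carries `S` to units of `C[X]` and
  -- extends to a homomorphism `C → C[X]`.
  have hu : ∀ s : S, IsUnit (((Polynomial.mapRingHom (algebraMap A C)).comp (epsilon 𝒜)) s) := by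
    intro s
    rw [RingHom.comp_apply, epsilon_of_mem 𝒜 (hS s s.2), Polynomial.monomial_zero_left,
      Polynomial.coe_mapRingHom, Polynomial.map_C]
    exact (IsLocalization.map_units C s).map Polynomial.C
  have := map_mem_E hc (IsLocalization.lift hu) h
  rwa [locGL, map_map_eq (ψ' := Polynomial.mapRingHom (algebraMap A C)) (φ' := epsilon 𝒜)
    (IsLocalization.lift_comp hu)] at this

/-- If the Quillen ideal of `ε(α)` contracted to a proper ideal of `A₀`, some maximal `𝔪` would
contain it; but descent from `A_𝔪` yields an element of it outside `𝔪`. So it is the unit ideal, and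
`α = ε(α)(1)` is elementary because `ε(α)(0) = I`. -/
theorem local_global [IsNoetherianRing A] (hc : c.Admissible n) {α : GL (Fin n) A}
    (h0 : plus 𝒜 α 0 = 1)
    (h : ∀ (𝔪 : Ideal (𝒜 0)) [𝔪.IsMaximal], locGL (LocAt 𝒜 𝔪) α ∈ E n (LocAt 𝒜 𝔪) c) :
    α ∈ E n A c := by
  have htop : (quillenIdeal c (epsilonGL 𝒜 α)).comap (algebraMap (𝒜 0) A) = ⊤ := by
    by_contra hne
    obtain ⟨𝔪, h𝔪, hle⟩ := Ideal.exists_le_maximal _ hne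
    have hmem := map_epsilonGL_mem_E 𝒜 hc (𝔪.primeCompl.map (algebraMap (𝒜 0) A))
      (by rintro _ ⟨s, -, rfl⟩; exact s.2) (LocAt 𝒜 𝔪) (h 𝔪)
    obtain ⟨_, ⟨s, hs, rfl⟩, hs'⟩ := exists_forall_map_mul_inv_mem_E
      (𝔪.primeCompl.map (algebraMap (𝒜 0) A)) (LocAt 𝒜 𝔪) hc _ hmem
    exact hs (hle hs')
  have h1 : quillenIdeal c (epsilonGL 𝒜 α) = ⊤ := by
    rw [Ideal.eq_top_iff_one] at htop ⊢
    rwa [Ideal.mem_comap, map_one] at htop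
  have := map_one_mul_map_zero_inv_mem_E h1
  have e0 := map_epsilonGL_eq_plus 𝒜 α 0
  rw [ZeroMemClass.coe_zero, h0] at e0
  rwa [map_epsilonGL_one, e0, inv_one, mul_one] at this

theorem dilation [IsNoetherianRing A] (hc : c.Admissible n) {α : GL (Fin n) A}
    (h0 : plus 𝒜 α 0 = 1) (s : 𝒜 0)
    (h : locGL (Localization.Away (s : A)) α ∈ E n (Localization.Away (s : A)) c) :
    ∃ l₀ : ℕ, ∀ l ≥ l₀, plus 𝒜 α (s ^ l) ∈ E n A c := by
  have hmem := map_epsilonGL_mem_E 𝒜 hc (Submonoid.powers (s : A))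
    (by rintro _ ⟨k, rfl⟩; exact (s ^ k).2) (Localization.Away (s : A)) h
  obtain ⟨_, ⟨k, rfl⟩, hk⟩ := exists_forall_map_mul_inv_mem_E (Submonoid.powers (s : A))
    (Localization.Away (s : A)) hc _ hmem
  refine ⟨k, fun l hl => ?_⟩
  -- Base point `0` and increment `s^k · s^(l-k) = s^l`: one `k` serves every larger exponent.
  have := hk 0 ((s : A) ^ (l - k))
  have e0 := map_epsilonGL_eq_plus 𝒜 α 0
  rw [ZeroMemClass.coe_zero, h0] at e0
  have e1 : ((s : A) ^ k) * (s : A) ^ (l - k) = ((s ^ l : 𝒜 0) : A) := by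
    rw [← pow_add, Nat.add_sub_cancel' hl]
    rfl
  rw [zero_add] at this
  erw [e1] at this
  rwa [e0, inv_one, mul_one, map_epsilonGL_eq_plus] at this

end Graded

end GradedClassical

/-! ### The equivalence. -/

theorem List.tfae_of_forall_true {l : List Prop} (h : ∀ p ∈ l, p) : l.TFAE :=
  fun p hp q hq => ⟨fun _ => h q hq, fun _ => h p hp⟩

theorem theorem3p7 {A : Type*} [CommRing A] [IsNoetherianRing A]
    (𝒜 : ℕ → AddSubgroup A) [GradedRing 𝒜]
    (c : Kind) (n : ℕ) (hn : c.Admissible n)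
    (h2 : c = Kind.orthogonal → (2 : A) ∈ nonZeroDivisors A) :
    List.TFAE [
      -- normality
      ((E n A c).subgroupOf (G n A c)).Normal,
      -- unimodular vectors
      ∀ v w : Fin n → A, IsUnimodular v → TransPair c v w → MemE c (1 + transMatrix c v w),
      -- graded local-global principle
      ∀ α ∈ G n A c, plus 𝒜 α 0 = 1 →
        (∀ (𝔪 : Ideal (𝒜 0)) [𝔪.IsMaximal], locGL (LocAt 𝒜 𝔪) α ∈ E n (LocAt 𝒜 𝔪) c) →
        α ∈ E n A c,
      -- graded dilation lemma
      ∀ α ∈ G n A c, plus 𝒜 α 0 = 1 → ∀ s : 𝒜 0, (s : A) ∈ nonZeroDivisors A →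
        locGL (Localization.Away (s : A)) α ∈ E n (Localization.Away (s : A)) c →
        ∃ l₀ : ℕ, ∀ l ≥ l₀, ∃ β ∈ E n A c,
          locGL (Localization.Away (s : A)) β =
            locGL (Localization.Away (s : A)) (plus 𝒜 α (s ^ l)),
      -- stability under the homotopy
      ∀ α ∈ E n A c, ∀ a : 𝒜 0, plus 𝒜 α a ∈ E n A c,
      -- vectors in the elementary orbit of the first basis vector
      ∀ v w : Fin n → A, (∃ g ∈ E n A c, v = (g : Matrix (Fin n) (Fin n) A) *ᵥ e₁ n A) →
        TransPair c v w → MemE c (1 + transMatrix c v w)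
    ] := by
  have hreg : TwoRegular c A := fun h x hx =>
    (mul_left_mem_nonZeroDivisors_eq_zero_iff (h2 h)).mp hx
  have h₂ : ∀ v w : Fin n → A, IsUnimodular v → TransPair c v w → MemE c (1 + transMatrix c v w) :=
    fun v w hv h => memE_one_add_transMatrix hn hreg hv h
  refine List.tfae_of_forall_true ?_
  simp only [List.mem_cons, List.not_mem_nil, or_false, forall_eq_or_imp, forall_eq]
  refine ⟨⟨fun x hx g => ?_⟩, h₂, ?_, ?_, ?_, ?_⟩
  · exact conj_mem_E hn hreg g.2 hx
  · intro α _ h0 h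
    exact local_global 𝒜 hn h0 h
  · intro α _ h0 s _ h
    obtain ⟨l₀, hl₀⟩ := dilation 𝒜 hn h0 s h
    -- The matrix `α⁺(s^l)` is itself elementary over `A`, so it serves as `β`.
    exact ⟨l₀, fun l hl => ⟨_, hl₀ l hl, rfl⟩⟩
  · intro α hα a
    exact map_mem_E hn (plusHom 𝒜 a) hα
  · rintro v w ⟨g, -, rfl⟩ h
    have hpos : 0 < n := by cases c <;> simp only [Kind.Admissible] at hn <;> omega
    have e : e₁ n A = bv A ⟨0, hpos⟩ := by
      ext i
      simp [e₁, bv, Pi.single_apply, Fin.ext_iff]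
    rw [e] at h ⊢
    exact h₂ _ _ (isUnimodular_mulVec_bv g _) h
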